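/- Let $\mathbb{K}$ be an algebraically closed field of characteristic zero. Fix integers $r\ge 1$, $m\ge 0$, an index $\iota\in\{0,1\}$, positive integers $n_\iota,\ldots,n_r$ with $n:=n_\iota+\cdots+n_r$, and tuples $l_i=(l_{i1},\ldots,l_{in_i})\in\mathbb{Z}_{>0}^{n_i}$ for $\iota\le i\le r$. In the polynomial ring $\mathbb{K}[T_{ij},S_k;\ \iota\le i\le r,\ 1\le j\le n_i,\ 1\le k\le m]$ put $T_i^{l_i}:=T_{i1}^{l_{i1}}\cdots T_{in_i}^{l_{in_i}}$. Consider one of the following two settings. Type 1: $\iota=1$, $A=(a_1,\ldots,a_r)$ is a list of pairwise different elements of $\mathbb{K}$, $I:=\{1,\ldots,r-1\}$, $g_i:=T_i^{l_i}-T_{i+1}^{l_{i+1}}-(a_{i+1}-a_i)$ for $i\in I$, and $P_0$ is the integral $r\times(n+m)$ matrix whose $t$-th row ($1\le t\le r$) has entry $l_{tj}$ in the column of $T_{tj}$, $1\le j\le n_t$, and all other entries $0$. Type 2: $\iota=0$, $A=(a_0,\ldots,a_r)$ is a $2\times(r+1)$ matrix over $\mathbb{K}$ with pairwise linearly independent columns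 $a_i\in\mathbb{K}^2$, $I:=\{0,\ldots,r-2\}$, $$g_i:=\det\begin{bmatrix}T_i^{l_i}&T_{i+1}^{l_{i+1}}&T_{i+2}^{l_{i+2}}\\ a_i&a_{i+1}&a_{i+2}\end{bmatrix}\quad\text{for } i\in I,$$ and $P_0$ is the integral $r\times(n+m)$ matrix whose $t$-th row ($1\le t\le r$) has entry $-l_{0j}$ in the column of $T_{0j}$, entry $l_{tj}$ in the column of $T_{tj}$, and all other entries $0$. Let $1\le s\le n+m-r$, let $d$ be an integral $s\times(n+m)$ matrix, and let $P=[P_0;d]$ be the $(r+s)\times(n+m)$ matrix obtained by stacking $P_0$ on top of $d$. Suppose that the downgrading is admissible, i.e. that the columns of $P$ are pairwise different primitive vectors of $\mathbb{Z}^{r+s}$ which generate $\mathbb{Q}^{r+s}$ as a vector space. Let $K:=\mathbb{Z}^{n+m}/\mathrm{im}(P^*)$, where $P^*$ is the transpose of $P$, with projection $Q\colon\mathbb{Z}^{n+m}\to K$, and let $R(A,P):=\mathbb{K}[T_{ij},S_k]/\langle g_i;\ i\in I\rangle$ carry the $K$-grading induced by $\deg(T_{ij}):=Q(e_{ij})$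 and $\deg(S_k):=Q(e_k)$, where $e_{ij},e_k$ denote the canonical basis vectors of $\mathbb{Z}^{n+m}$. Then this is a well-defined $K$-grading and the following hold. (i) The $K$-grading on $R(A,P)$ is almost free (after removing any one of the variables $T_{ij},S_k$, the degrees of the remaining ones still generate $K$) and factorial (the non-zero homogeneous elements of $R(A,P)$ form a multiplicative monoid with unique factorization into irreducibles up to order and units), and every invertible homogeneous element of $R(A,P)$ is a constant from $\mathbb{K}^*$. (ii) The variables $T_{ij}$ and $S_k$ define pairwise different, pairwise nonassociated $K$-prime generators of the $\mathbb{K}$-algebra $R(A,P)$, where a $K$-prime is a homogeneous non-zero non-unit which, whenever it divides a product of homogeneous elements, also divides one of the factors. -/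

import Mathlib

open MvPolynomial

namespace ComplexityOne

universe u

/-- Block sizes `n_i > 0` for the `q` blocks of variables `T_{ij}`, positive exponent vectors `l_i`,
and the number `m ≥ 0` of additional variables `S_k`. -/
structure Shape (q : ℕ) where
  size : Fin q → ℕ
  size_pos : ∀ i, 0 < size i
  l : ∀ i, Fin (size i) → ℕ
  l_pos : ∀ i j, 0 < l i j
  m : ℕ

namespace Shape

variable {q : ℕ}

/-- The variables: `Sum.inl ⟨i, j⟩` is `T_{ij}` and `Sum.inr k` is `S_k`. -/
abbrev Var (c : Shape q) : Type := (Σ i : Fin q, Fin (c.size i)) ⊕ Fin c.m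

/-- The monomial `T_i^{l_i}`. -/
noncomputable def mon (c : Shape q) (𝕂 : Type u) [CommRing 𝕂] (i : Fin q) : MvPolynomial c.Var 𝕂 :=
  ∏ j : Fin (c.size i), X (Sum.inl ⟨i, j⟩) ^ c.l i j

/-- Type 1 relations `T_i^{l_i} - T_{i+1}^{l_{i+1}} - (a_{i+1} - a_i)`, for all pairs of consecutive
blocks. -/
def relations₁ (c : Shape q) {𝕂 : Type u} [CommRing 𝕂] (a : Fin q → 𝕂) :
    Set (MvPolynomial c.Var 𝕂) :=
  {g | ∃ i i' : Fin q, i'.val = i.val + 1 ∧ g = c.mon 𝕂 i - c.mon 𝕂 i' - C (a i' - a i)}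

/-- Type 2 relations `det (T_i^{l_i}, T_{i+1}^{l_{i+1}}, T_{i+2}^{l_{i+2}}; a_i, a_{i+1}, a_{i+2})`,
for all triples of consecutive blocks; `a_i` is the `i`-th column of `a`. -/
def relations₂ (c : Shape q) {𝕂 : Type u} [CommRing 𝕂] (a : Matrix (Fin 2) (Fin q) 𝕂) :
    Set (MvPolynomial c.Var 𝕂) :=
  {g | ∃ i i' i'' : Fin q, i'.val = i.val + 1 ∧ i''.val = i.val + 2 ∧
    g = Matrix.det !![c.mon 𝕂 i, c.mon 𝕂 i', c.mon 𝕂 i'';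
                      C (a 0 i), C (a 0 i'), C (a 0 i'');
                      C (a 1 i), C (a 1 i'), C (a 1 i'')]}

/-- Type 1 matrix: the block `l_t` in row `t`, and zero columns for the `S_k`. -/
def P₀₁ {r : ℕ} (c : Shape r) : Matrix (Fin r) c.Var ℤ := fun t x =>
  match x with
  | Sum.inl ⟨i, j⟩ => if i = t then (c.l i j : ℤ) else 0
  | Sum.inr _ => 0

/-- Type 2 matrix: row `t` (`1 ≤ t ≤ r`) has the block `-l_0` and the block `l_t`; zero columns for
the `S_k`. -/
def P₀₂ {r : ℕ} (c : Shape (r + 1)) : Matrix (Fin r) c.Var ℤ := fun t x =>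
  match x with
  | Sum.inl ⟨i, j⟩ => if i = 0 then -(c.l i j : ℤ) else if i = t.succ then (c.l i j : ℤ) else 0
  | Sum.inr _ => 0

end Shape

/-- The input data of Type 1 (blocks `1, …, r`, pairwise different scalars `a_1, …, a_r`) or of
Type 2 (blocks `0, …, r`, a `2 × (r+1)` matrix with pairwise linearly independent columns). -/
inductive Data (𝕂 : Type u) [Field 𝕂] (r : ℕ) : Type u
  | type1 (c : Shape r) (a : Fin r → 𝕂) (ha : Function.Injective a) : Data 𝕂 r
  | type2 (c : Shape (r + 1)) (a : Matrix (Fin 2) (Fin (r + 1)) 𝕂)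
      (ha : ∀ i j, i ≠ j → LinearIndependent 𝕂 ![a.col i, a.col j]) : Data 𝕂 r

namespace Data

variable {𝕂 : Type u} [Field 𝕂] {r : ℕ}

/-- Number of blocks: `r` for Type 1 and `r + 1` for Type 2. -/
def numBlocks : Data 𝕂 r → ℕ
  | type1 _ _ _ => r
  | type2 _ _ _ => r + 1

def shape : (D : Data 𝕂 r) → Shape D.numBlocks
  | type1 c _ _ => c
  | type2 c _ _ => c

/-- The index set of the `n + m` variables `T_{ij}, S_k`. -/
abbrev Var (D : Data 𝕂 r) : Type := D.shape.Var

/-- The relations `g_i`, `i ∈ I`. -/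
def relations : (D : Data 𝕂 r) → Set (MvPolynomial D.Var 𝕂)
  | type1 c a _ => c.relations₁ a
  | type2 c a _ => c.relations₂ a

/-- The `r × (n + m)` matrix `P₀`. -/
def P₀ : (D : Data 𝕂 r) → Matrix (Fin r) D.Var ℤ
  | type1 c _ _ => c.P₀₁
  | type2 c _ _ => c.P₀₂

/-- The stack matrix `P = [P₀; d]`. -/
def P (D : Data 𝕂 r) {s : ℕ} (d : Matrix (Fin s) D.Var ℤ) : Matrix (Fin r ⊕ Fin s) D.Var ℤ :=
  Matrix.fromRows D.P₀ d

/-- The ring `R(A, P) = 𝕂[T_{ij}, S_k] / ⟨g_i; i ∈ I⟩` (the matrix `d` only affects the grading). -/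
abbrev R (D : Data 𝕂 r) : Type u := MvPolynomial D.Var 𝕂 ⧸ Ideal.span D.relations

/-- The element of `R(A, P)` defined by a variable `T_{ij}` or `S_k`. -/
noncomputable def var (D : Data 𝕂 r) (x : D.Var) : D.R := Ideal.Quotient.mk _ (X x)

end Data

section Grading

variable {ρ σ : Type} [Fintype ρ] [Fintype σ]

/-- The columns are pairwise different primitive vectors generating the rational vector space. -/
structure IsAdmissible (P : Matrix ρ σ ℤ) : Prop where
  injective : Function.Injective P.col
  primitive : ∀ x, Finset.univ.gcd (P.col x) = 1
  generate : Submodule.span ℚ (Set.range fun x : σ => fun t : ρ => (P t x : ℚ)) = ⊤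

/-- The group `K = ℤ^{n+m} / im(P^*)`. -/
abbrev GradGroup (P : Matrix ρ σ ℤ) : Type := (σ → ℤ) ⧸ LinearMap.range P.transpose.mulVecLin

open Classical in
/-- The degree `Q(e_x) ∈ K` of the variable with index `x`. -/
noncomputable def deg (P : Matrix ρ σ ℤ) (x : σ) : GradGroup P :=
  Submodule.Quotient.mk (Pi.single x 1)

end Grading

/-- The `K`-grading of `R(A, P)`: the component of degree `w` consists of the classes of the
polynomials that are homogeneous of degree `w`. -/
noncomputable def Data.grading {𝕂 : Type u} [Field 𝕂] {r : ℕ} (D : Data 𝕂 r) {s : ℕ}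
    (d : Matrix (Fin s) D.Var ℤ) (w : GradGroup (D.P d)) : Submodule 𝕂 D.R :=
  (weightedHomogeneousSubmodule 𝕂 (deg (D.P d)) w).map
    (Ideal.Quotient.mkₐ 𝕂 (Ideal.span D.relations)).toLinearMap

section Factorial

variable {𝕂 : Type*} {A : Type*} {K : Type*} [CommRing 𝕂] [CommRing A] [Algebra 𝕂 A] [AddCommGroup K]

open Classical in
/-- The submodules `𝒜 w` turn `A` into a `K`-graded algebra `A = ⨁ 𝒜 w`. -/
def IsGrading (𝒜 : K → Submodule 𝕂 A) : Prop :=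
  SetLike.GradedMonoid 𝒜 ∧ DirectSum.IsInternal 𝒜

/-- `K`-prime: a homogeneous non-zero non-unit which, whenever it divides a product of homogeneous
elements, divides one of the factors. -/
def IsGradedPrime (𝒜 : K → Submodule 𝕂 A) (p : A) : Prop :=
  SetLike.IsHomogeneousElem 𝒜 p ∧ p ≠ 0 ∧ ¬ IsUnit p ∧
    ∀ f g, SetLike.IsHomogeneousElem 𝒜 f → SetLike.IsHomogeneousElem 𝒜 g →
      p ∣ f * g → p ∣ f ∨ p ∣ g

/-- Irreducible elements of the monoid of non-zero homogeneous elements. -/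
def IsGradedIrreducible (𝒜 : K → Submodule 𝕂 A) (p : A) : Prop :=
  SetLike.IsHomogeneousElem 𝒜 p ∧ p ≠ 0 ∧ ¬ IsUnit p ∧
    ∀ f g, SetLike.IsHomogeneousElem 𝒜 f → SetLike.IsHomogeneousElem 𝒜 g →
      p = f * g → IsUnit f ∨ IsUnit g

/-- Factorial grading: the non-zero homogeneous elements form a multiplicative monoid with unique
factorization into irreducibles, up to order and units. -/
structure IsFactorialGrading (𝒜 : K → Submodule 𝕂 A) : Prop where
  one_ne_zero : (1 : A) ≠ 0
  mul_ne_zero : ∀ f g, SetLike.IsHomogeneousElem 𝒜 f → SetLike.IsHomogeneousElem 𝒜 g →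
    f ≠ 0 → g ≠ 0 → f * g ≠ 0
  exists_factors : ∀ f, SetLike.IsHomogeneousElem 𝒜 f → f ≠ 0 → ¬ IsUnit f →
    ∃ S : Multiset A, (∀ p ∈ S, IsGradedIrreducible 𝒜 p) ∧ S.prod = f
  unique_factors : ∀ S S' : Multiset A, (∀ p ∈ S, IsGradedIrreducible 𝒜 p) →
    (∀ p ∈ S', IsGradedIrreducible 𝒜 p) → Associated S.prod S'.prod →
      Multiset.Rel Associated S S'

/-- Every invertible homogeneous element is a constant from `𝕂ˣ`. -/
def OnlyConstantHomogeneousUnits (𝒜 : K → Submodule 𝕂 A) : Prop :=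
  ∀ f, SetLike.IsHomogeneousElem 𝒜 f → IsUnit f → ∃ c : 𝕂ˣ, f = algebraMap 𝕂 A c

/-- Almost free: after removing any one variable, the degrees of the remaining ones still generate
the grading group. -/
def IsAlmostFree {σ : Type*} (δ : σ → K) : Prop :=
  ∀ x, AddSubgroup.closure (δ '' {y | y ≠ x}) = ⊤

end Factorial

end ComplexityOne

/-!
The relations express that the monomials `T_i ^ l_i` are pairwise non-proportional binary linear
forms in two parameters (in the inhomogeneous case, one of the forms is the constant `1`, which is
the monomial of an additional empty block of variables). This common shape is `Trinomial`: all
block monomials are combinations `δ t * T_0 ^ l_0 + β t * T_1 ^ l_1`.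

The argument is Nagata's. After inverting the variables, the degree zero part of the algebra is a
localization of a polynomial ring `𝕂[z][y_1, …, y_s]` (`Trinomial.Base`), in which `z` is the
quotient of the first two block monomials, the remaining quotients are linear polynomials in `z`,
and the `y_k` are the Laurent monomials given by the rows of `d`. If the variables are prime, unique
factorization of homogeneous elements follows from the one in this polynomial ring.

No localization is formed. Instead everything is evaluated at points over an algebraically closed
field `F` containing the polynomial ring. The group of units of `F` is divisible, so a homomorphism
from the group of exponent vectors of degree zero to these units extends to all exponent vectors,
and such an extension is a point of the torus (`Trinomial.IsGradedBy.exists_point`; the rows of `P`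
are independent because its columns generate the rational vector space). Two kinds of points are
used.

* At a generic point, a homogeneous polynomial vanishes only if it lies in the ideal of relations
  (`Trinomial.IsGradedBy.mem_span_relations`). By independence of the `y_k` this is a statement on
  polynomials whose exponents differ by combinations of the block exponents, which modulo the
  relations are monomials times binary forms in two of the block monomials. In particular there are
  no homogeneous zero divisors.
* For each variable there is a homomorphism to a field which kills this variable, no other variable,
  and a homogeneous element only if the latter is divisible by the variable
  (`Trinomial.IsGradedBy.exists_detecting_hom`). If the variable belongs to a block, the remaining
  block monomials take non-zero values there, as the linear forms are pairwise non-proportional.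
  Hence the variables are graded primes and none divides another one.

The abstract form of Nagata's argument is `IsGenericPoint.isFactorialGrading`, and
`IsGenericPoint.exists_unit_of_isUnit` for the homogeneous units. Almost freeness is the primitivity
of the columns (`isAlmostFree_deg`).
-/

namespace ComplexityOne

/-! ### Factoriality from graded prime factors -/

section GradedFactoriality

variable {𝕂 A K : Type*} [CommRing 𝕂] [CommRing A] [Algebra 𝕂 A] [AddCommGroup K]
  {𝒜 : K → Submodule 𝕂 A}

/-- In a graded ring, the quotient of homogeneous elements may be chosen homogeneous. -/
theorem IsGrading.exists_mem_of_dvd (hG : IsGrading 𝒜) {i k : K} {f h : A} (hf : f ∈ 𝒜 i)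
    (hh : h ∈ 𝒜 k) (hdvd : f ∣ h) : ∃ g ∈ 𝒜 (k - i), h = f * g := by
  classical
  obtain ⟨g, rfl⟩ := hdvd
  obtain ⟨h1, h2⟩ := hG
  have h2' : DirectSum.IsInternal 𝒜 := by convert h2
  let := h2'.chooseDecomposition
  let : GradedRing 𝒜 := { }
  refine ⟨DirectSum.decompose 𝒜 g (k - i), SetLike.coe_mem _, ?_⟩
  have := DirectSum.coe_decompose_mul_add_of_left_mem 𝒜 (b := g) (j := k - i) hf
  rw [← this, add_sub_cancel, DirectSum.decompose_of_mem_same 𝒜 hh]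

theorem IsGrading.mem_mul (hG : IsGrading 𝒜) {i j : K} {f g : A} (hf : f ∈ 𝒜 i)
    (hg : g ∈ 𝒜 j) : f * g ∈ 𝒜 (i + j) :=
  hG.1.mul_mem hf hg

theorem IsGrading.one_mem (hG : IsGrading 𝒜) : (1 : A) ∈ 𝒜 0 :=
  hG.1.one_mem

theorem IsGrading.isHomogeneousElem_mul (hG : IsGrading 𝒜) {f g : A}
    (hf : SetLike.IsHomogeneousElem 𝒜 f) (hg : SetLike.IsHomogeneousElem 𝒜 g) :
    SetLike.IsHomogeneousElem 𝒜 (f * g) := by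
  obtain ⟨i, hi⟩ := hf
  obtain ⟨j, hj⟩ := hg
  exact ⟨_, hG.mem_mul hi hj⟩

theorem IsGrading.isHomogeneousElem_one (hG : IsGrading 𝒜) :
    SetLike.IsHomogeneousElem 𝒜 (1 : A) := ⟨0, hG.one_mem⟩

theorem IsGrading.isHomogeneousElem_multiset_prod (hG : IsGrading 𝒜) (S : Multiset A)
    (hS : ∀ p ∈ S, SetLike.IsHomogeneousElem 𝒜 p) : SetLike.IsHomogeneousElem 𝒜 S.prod := by
  induction S using Multiset.induction_on with
  | empty => simpa using hG.isHomogeneousElem_one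
  | cons a S ih =>
    rw [Multiset.prod_cons]
    exact hG.isHomogeneousElem_mul (hS a (Multiset.mem_cons_self a S))
      (ih fun p hp => hS p (Multiset.mem_cons_of_mem hp))

theorem IsGrading.exists_homogeneous_of_dvd (hG : IsGrading 𝒜) {f h : A}
    (hf : SetLike.IsHomogeneousElem 𝒜 f) (hh : SetLike.IsHomogeneousElem 𝒜 h) (hdvd : f ∣ h) :
    ∃ g, SetLike.IsHomogeneousElem 𝒜 g ∧ h = f * g := by
  obtain ⟨i, hi⟩ := hf
  obtain ⟨k, hk⟩ := hh
  obtain ⟨g, hg, e⟩ := hG.exists_mem_of_dvd hi hk hdvd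
  exact ⟨g, ⟨_, hg⟩, e⟩

theorem IsGrading.eq_of_mem_of_mem (hG : IsGrading 𝒜) {i j : K} {f : A} (hi : f ∈ 𝒜 i)
    (hj : f ∈ 𝒜 j) (hf : f ≠ 0) : i = j := by
  classical
  have h2' : DirectSum.IsInternal 𝒜 := by convert hG.2
  let := h2'.chooseDecomposition
  exact DirectSum.degree_eq_of_mem_mem 𝒜 hi hj hf

/-- Homogeneous elements can be cancelled if there are no homogeneous zero divisors. -/
theorem IsGrading.mul_left_cancel (hG : IsGrading 𝒜)
    (hmul : ∀ f g, SetLike.IsHomogeneousElem 𝒜 f → SetLike.IsHomogeneousElem 𝒜 g →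
      f ≠ 0 → g ≠ 0 → f * g ≠ 0) {f g h : A} (hf : SetLike.IsHomogeneousElem 𝒜 f)
    (hg : SetLike.IsHomogeneousElem 𝒜 g) (hh : SetLike.IsHomogeneousElem 𝒜 h) (hf0 : f ≠ 0)
    (e : f * g = f * h) : g = h := by
  by_cases hg0 : g = 0
  · by_contra hne
    exact hmul f h hf hh hf0 (fun h0 => hne (hg0.trans h0.symm)) (by rw [← e, hg0, mul_zero])
  · obtain ⟨i, hi⟩ := hf
    obtain ⟨j, hj⟩ := hg
    obtain ⟨k, hk⟩ := hh
    have hfg : f * g ≠ 0 := hmul f g ⟨i, hi⟩ ⟨j, hj⟩ hf0 hg0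
    have hijk : i + j = i + k :=
      hG.eq_of_mem_of_mem (hG.mem_mul hi hj) (e ▸ hG.mem_mul hi hk) hfg
    have hjk : j = k := add_left_cancel hijk
    subst hjk
    by_contra hne
    exact hmul f (g - h) ⟨i, hi⟩ ⟨j, sub_mem hj hk⟩ hf0 (sub_ne_zero.mpr hne)
      (by rw [mul_sub, e, sub_self])

/-- A grading without homogeneous zero divisors, in which every non-zero homogeneous element is
associated to a product of graded primes, is factorial. -/
theorem isFactorialGrading_of_exists_gradedPrime_factors (hG : IsGrading 𝒜)
    (h1 : (1 : A) ≠ 0)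
    (hmul : ∀ f g, SetLike.IsHomogeneousElem 𝒜 f → SetLike.IsHomogeneousElem 𝒜 g →
      f ≠ 0 → g ≠ 0 → f * g ≠ 0)
    (hfac : ∀ f, SetLike.IsHomogeneousElem 𝒜 f → f ≠ 0 →
      ∃ S : Multiset A, (∀ p ∈ S, IsGradedPrime 𝒜 p) ∧ Associated S.prod f) :
    IsFactorialGrading 𝒜 := by
  have hdvd_one : ∀ {f g h : A}, SetLike.IsHomogeneousElem 𝒜 f → SetLike.IsHomogeneousElem 𝒜 g →
      SetLike.IsHomogeneousElem 𝒜 h → f ≠ 0 → f = f * g * h → IsUnit g := by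
    intro f g h hf hg hh hf0 e
    refine IsUnit.of_mul_eq_one h (hG.mul_left_cancel hmul hf (hG.isHomogeneousElem_mul hg hh)
      hG.isHomogeneousElem_one hf0 ?_)
    rw [mul_one, ← mul_assoc, ← e]
  have prime_irred : ∀ p, IsGradedPrime 𝒜 p → IsGradedIrreducible 𝒜 p := by
    rintro p ⟨hp, hp0, hpu, hpd⟩
    refine ⟨hp, hp0, hpu, fun f g hf hg e => ?_⟩
    rcases hpd f g hf hg (dvd_of_eq e) with h | h
    · obtain ⟨k, hk, rfl⟩ := hG.exists_homogeneous_of_dvd hp hf h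
      exact Or.inr (hdvd_one hp hg hk hp0 (by rw [mul_right_comm]; exact e))
    · obtain ⟨k, hk, rfl⟩ := hG.exists_homogeneous_of_dvd hp hg h
      exact Or.inl (hdvd_one hp hf hk hp0 (by rw [mul_comm p f, mul_assoc]; exact e))
  have irred_dvd : ∀ {p q : A}, IsGradedIrreducible 𝒜 q → IsGradedPrime 𝒜 p → p ∣ q →
      Associated p q := by
    intro p q hq hp h
    obtain ⟨k, hk, rfl⟩ := hG.exists_homogeneous_of_dvd hp.1 hq.1 h
    rcases hq.2.2.2 p k hp.1 hk rfl with h' | h'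
    · exact absurd h' hp.2.2.1
    · exact ⟨h'.unit, by simp⟩
  have irred_prime : ∀ q, IsGradedIrreducible 𝒜 q → IsGradedPrime 𝒜 q := by
    intro q hq
    obtain ⟨S, hS, hSq⟩ := hfac q hq.1 hq.2.1
    rcases S.empty_or_exists_mem with rfl | ⟨p, hpS⟩
    · exact absurd (hSq.symm.isUnit_iff.mpr (by simp)) hq.2.2.1
    · have hp := hS p hpS
      have hpq : Associated p q := irred_dvd hq hp ((Multiset.dvd_prod hpS).trans hSq.dvd)
      refine ⟨hq.1, hq.2.1, hq.2.2.1, fun f g hf hg hd => ?_⟩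
      exact (hp.2.2.2 f g hf hg (hpq.dvd.trans hd)).imp (hpq.symm.dvd.trans ·)
        (hpq.symm.dvd.trans ·)
  have exists_dvd_of_dvd_prod : ∀ {p : A}, IsGradedPrime 𝒜 p → ∀ S : Multiset A,
      (∀ q ∈ S, SetLike.IsHomogeneousElem 𝒜 q) → p ∣ S.prod → ∃ q ∈ S, p ∣ q := by
    intro p hp S
    induction S using Multiset.induction_on with
    | empty => exact fun _ h => absurd (isUnit_of_dvd_one (by simpa using h)) hp.2.2.1
    | cons a S ih =>
      intro hS h
      rw [Multiset.prod_cons] at h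
      have hS' : ∀ q ∈ S, SetLike.IsHomogeneousElem 𝒜 q :=
        fun q hq => hS q (Multiset.mem_cons_of_mem hq)
      rcases hp.2.2.2 _ _ (hS a (Multiset.mem_cons_self a S))
        (hG.isHomogeneousElem_multiset_prod S hS') h with h | h
      · exact ⟨a, Multiset.mem_cons_self a S, h⟩
      · obtain ⟨q, hq, hd⟩ := ih hS' h
        exact ⟨q, Multiset.mem_cons_of_mem hq, hd⟩
  refine ⟨h1, hmul, ?_, ?_⟩
  · intro f hf hf0 hfu
    obtain ⟨S, hS, hSf⟩ := hfac f hf hf0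
    rcases S.empty_or_exists_mem with rfl | ⟨p, hpS⟩
    · exact absurd (hSf.isUnit_iff.mp (by simp)) hfu
    · obtain ⟨S, rfl⟩ := Multiset.exists_cons_of_mem hpS
      -- The unit is absorbed into one of the factors.
      obtain ⟨u, hu, e⟩ := hG.exists_homogeneous_of_dvd
        (hG.isHomogeneousElem_multiset_prod _ fun q hq => (hS q hq).1) hf hSf.dvd
      obtain ⟨v, hv, e'⟩ := hG.exists_homogeneous_of_dvd hf
        (hG.isHomogeneousElem_multiset_prod _ fun q hq => (hS q hq).1) hSf.symm.dvd
      have huu : IsUnit u := by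
        refine hdvd_one (hG.isHomogeneousElem_multiset_prod _ fun q hq => (hS q hq).1) hu hv
          ?_ (e ▸ e')
        intro h0
        exact hf0 (by rw [e, h0, zero_mul])
      have hp := prime_irred p (hS p (Multiset.mem_cons_self p S))
      refine ⟨(p * u) ::ₘ S, ?_, by rw [Multiset.prod_cons, e, Multiset.prod_cons]; ring⟩
      intro q hq
      rcases Multiset.mem_cons.mp hq with rfl | hq
      · refine ⟨hG.isHomogeneousElem_mul hp.1 hu, fun h0 => hp.2.1 ?_, fun h => hp.2.2.1 ?_, ?_⟩
        · exact (huu.mul_left_eq_zero).mp h0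
        · exact isUnit_of_mul_isUnit_left h
        · intro a b ha hb hab
          have hinv : p ∣ a * b := ⟨u, hab.symm⟩
          rcases (hS p (Multiset.mem_cons_self p S)).2.2.2 a b ha hb hinv with h | h
          · obtain ⟨k, hk, rfl⟩ := hG.exists_homogeneous_of_dvd hp.1 ha h
            right
            have : u = k * b := hG.mul_left_cancel hmul hp.1 hu (hG.isHomogeneousElem_mul hk hb)
              hp.2.1 (by rw [hab, mul_assoc])
            rw [this] at huu
            exact isUnit_of_mul_isUnit_right huu
          · obtain ⟨k, hk, rfl⟩ := hG.exists_homogeneous_of_dvd hp.1 hb h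
            left
            have : u = k * a := hG.mul_left_cancel hmul hp.1 hu (hG.isHomogeneousElem_mul hk ha)
              hp.2.1 (by rw [hab]; ring)
            rw [this] at huu
            exact isUnit_of_mul_isUnit_right huu
      · exact prime_irred q (hS q (Multiset.mem_cons_of_mem hq))
  · intro S
    induction S using Multiset.induction_on with
    | empty =>
      intro S' _ hS' h
      rcases S'.empty_or_exists_mem with rfl | ⟨p, hp⟩
      · exact Multiset.Rel.zero
      · refine absurd (isUnit_of_dvd_unit (Multiset.dvd_prod hp) ?_) (hS' p hp).2.2.1
        exact h.isUnit_iff.mp (by simp)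
    | cons p S ih =>
      intro S' hS hS' h
      classical
      have hp := irred_prime p (hS p (Multiset.mem_cons_self p S))
      obtain ⟨q, hqS, hpq⟩ := exists_dvd_of_dvd_prod hp S' (fun q hq => (hS' q hq).1)
        ((Multiset.dvd_prod (Multiset.mem_cons_self p S)).trans h.dvd)
      have hpq := irred_dvd (hS' q hqS) hp hpq
      obtain ⟨S', rfl⟩ := Multiset.exists_cons_of_mem hqS
      refine Multiset.Rel.cons hpq (ih S' (fun a ha => hS a (Multiset.mem_cons_of_mem ha))
        (fun a ha => hS' a (Multiset.mem_cons_of_mem ha)) ?_)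
      have hSh := hG.isHomogeneousElem_multiset_prod S
        fun a ha => (hS a (Multiset.mem_cons_of_mem ha)).1
      have hSh' := hG.isHomogeneousElem_multiset_prod S'
        fun a ha => (hS' a (Multiset.mem_cons_of_mem ha)).1
      rw [Multiset.prod_cons, Multiset.prod_cons] at h
      have h' : Associated (p * S.prod) (p * S'.prod) := h.trans (hpq.symm.mul_right _)
      obtain ⟨a, ha, ea⟩ := hG.exists_homogeneous_of_dvd (hG.isHomogeneousElem_mul hp.1 hSh)
        (hG.isHomogeneousElem_mul hp.1 hSh') h'.dvd
      have hne : ∀ T : Multiset A, (∀ a ∈ T, IsGradedIrreducible 𝒜 a) → T.prod ≠ 0 := by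
        intro T
        induction T using Multiset.induction_on with
        | empty => exact fun _ => by simpa using h1
        | cons b T ih =>
          intro hT
          rw [Multiset.prod_cons]
          exact hmul _ _ (hT b (Multiset.mem_cons_self b T)).1
            (hG.isHomogeneousElem_multiset_prod T
              fun a ha => (hT a (Multiset.mem_cons_of_mem ha)).1)
            (hT b (Multiset.mem_cons_self b T)).2.1
            (ih fun a ha => hT a (Multiset.mem_cons_of_mem ha))
      have hS0 : S.prod ≠ 0 := hne S fun a ha => hS a (Multiset.mem_cons_of_mem ha)
      obtain ⟨b, hb, eb⟩ := hG.exists_homogeneous_of_dvd (hG.isHomogeneousElem_mul hp.1 hSh')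
        (hG.isHomogeneousElem_mul hp.1 hSh) h'.symm.dvd
      have hau : IsUnit a := hdvd_one (hG.isHomogeneousElem_mul hp.1 hSh) ha hb
        (hmul _ _ hp.1 hSh hp.2.1 hS0) (ea ▸ eb)
      have e1 : S'.prod = S.prod * a := hG.mul_left_cancel hmul hp.1 hSh'
        (hG.isHomogeneousElem_mul hSh ha) hp.2.1 (by rw [ea, mul_assoc])
      exact ⟨hau.unit, by rw [IsUnit.unit_spec, e1]⟩

end GradedFactoriality

/-! ### Nagata's argument at a generic point -/

section LaurentEvaluation

variable {σ F : Type*} [Fintype σ] [Field F]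

/-- The value `∏ y, θ y ^ x y` at the point `θ` of the Laurent monomial with exponent vector `x`. -/
def laurentEval (θ : σ → F) (x : σ → ℤ) : F := ∏ y, θ y ^ x y

theorem laurentEval_zero (θ : σ → F) : laurentEval θ 0 = 1 := by
  simp [laurentEval]

theorem laurentEval_add {θ : σ → F} (hθ : ∀ y, θ y ≠ 0) (x x' : σ → ℤ) :
    laurentEval θ (x + x') = laurentEval θ x * laurentEval θ x' := by
  simp [laurentEval, zpow_add₀ (hθ _), Finset.prod_mul_distrib]

theorem laurentEval_neg (θ : σ → F) (x : σ → ℤ) :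
    laurentEval θ (-x) = (laurentEval θ x)⁻¹ := by
  simp [laurentEval, Finset.prod_inv_distrib]

theorem laurentEval_sub {θ : σ → F} (hθ : ∀ y, θ y ≠ 0) (x x' : σ → ℤ) :
    laurentEval θ (x - x') = laurentEval θ x / laurentEval θ x' := by
  rw [sub_eq_add_neg, laurentEval_add hθ, laurentEval_neg, div_eq_mul_inv]

theorem laurentEval_ne_zero {θ : σ → F} (hθ : ∀ y, θ y ≠ 0) (x : σ → ℤ) :
    laurentEval θ x ≠ 0 :=
  Finset.prod_ne_zero_iff.mpr fun y _ => zpow_ne_zero _ (hθ y)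

theorem laurentEval_natCast (θ : σ → F) (n : σ → ℕ) :
    laurentEval θ (fun y => (n y : ℤ)) = ∏ y, θ y ^ n y := by
  simp [laurentEval]

end LaurentEvaluation

section Nagata

variable {𝕂 A K F C σ : Type*} [CommRing 𝕂] [CommRing A] [Algebra 𝕂 A] [AddCommGroup K]
  [Field F] [CommRing C] [Fintype σ]

/-- `Θ : A → F` is a generic point of the graded algebra `A` with respect to homogeneous elements
`v y` of degree `w y`: it does not kill non-zero homogeneous elements, and the values of the
homogeneous elements are, up to values of Laurent monomials in the `v y`, precisely the elements of
the ring `C ⊆ F`. The primes `u ∈ U` of `C` are values of Laurent monomials of degree zero, and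
generate these values. -/
structure IsGenericPoint (𝒜 : K → Submodule 𝕂 A) (w : σ → K) (v : σ → A) (Θ : A →+* F)
    (ι : C →+* F) (U : Set C) : Prop where
  isGrading : IsGrading 𝒜
  injective : Function.Injective ι
  mem : ∀ y, v y ∈ 𝒜 (w y)
  map_ne_zero : ∀ y, Θ (v y) ≠ 0
  eq_zero : ∀ k, ∀ f ∈ 𝒜 k, Θ f = 0 → f = 0
  exists_rep : ∀ k, ∀ f ∈ 𝒜 k, f ≠ 0 → ∃ x c, Fintype.linearCombination ℤ w x = k ∧
    Θ f = laurentEval (Θ ∘ v) x * ι c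
  exists_lift : ∀ c, ∃ x, ∃ h ∈ 𝒜 (Fintype.linearCombination ℤ w x),
    Θ h = laurentEval (Θ ∘ v) x * ι c
  prime_of_mem : ∀ u ∈ U, Prime u
  exists_of_mem : ∀ u ∈ U, ∃ x, Fintype.linearCombination ℤ w x = 0 ∧
    laurentEval (Θ ∘ v) x = ι u
  exists_closure : ∀ x, Fintype.linearCombination ℤ w x = 0 →
    ∃ u ∈ Submonoid.closure U, ∃ u' ∈ Submonoid.closure U,
      laurentEval (Θ ∘ v) x * ι u = ι u'
  exists_unit : ∀ ε : Cˣ, ∃ a ∈ 𝒜 0, IsUnit a ∧ Θ a = ι ε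
  isGradedPrime : ∀ y, IsGradedPrime 𝒜 (v y)
  not_dvd : ∀ y z, y ≠ z → ¬ v y ∣ v z

/-- `c ∈ C` represents the homogeneous element `f`: the value of `f` at the generic point is `c`, up
to a unit of `C` and the value of a Laurent monomial of the degree of `f`. -/
def Represents (𝒜 : K → Submodule 𝕂 A) (w : σ → K) (v : σ → A) (Θ : A →+* F)
    (ι : C →+* F) (f : A) (c : C) : Prop :=
  ∃ x, ∃ ε : Cˣ, f ∈ 𝒜 (Fintype.linearCombination ℤ w x) ∧
    Θ f = laurentEval (Θ ∘ v) x * ι (ε * c)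

variable {𝒜 : K → Submodule 𝕂 A} {w : σ → K} {v : σ → A} {Θ : A →+* F} {ι : C →+* F} {U : Set C}

namespace IsGenericPoint

theorem comp_ne_zero (hp : IsGenericPoint 𝒜 w v Θ ι U) (y : σ) : (Θ ∘ v) y ≠ 0 :=
  hp.map_ne_zero y

theorem map_laurentEval_ne_zero (hp : IsGenericPoint 𝒜 w v Θ ι U) (x : σ → ℤ) :
    laurentEval (Θ ∘ v) x ≠ 0 :=
  laurentEval_ne_zero hp.comp_ne_zero x

theorem one_ne_zero (_hp : IsGenericPoint 𝒜 w v Θ ι U) : (1 : A) ≠ 0 := fun h => by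
  simpa using congrArg Θ h

theorem eq_of_map_eq (hp : IsGenericPoint 𝒜 w v Θ ι U) {k : K} {f g : A} (hf : f ∈ 𝒜 k)
    (hg : g ∈ 𝒜 k) (h : Θ f = Θ g) : f = g :=
  sub_eq_zero.mp (hp.eq_zero k _ (sub_mem hf hg) (by rw [map_sub, h, sub_self]))

theorem map_ne_zero_of_ne_zero (hp : IsGenericPoint 𝒜 w v Θ ι U) {f : A}
    (hf : SetLike.IsHomogeneousElem 𝒜 f) (hf0 : f ≠ 0) : Θ f ≠ 0 := by
  obtain ⟨k, hk⟩ := hf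
  exact fun h => hf0 (hp.eq_zero k f hk h)

theorem mul_ne_zero (hp : IsGenericPoint 𝒜 w v Θ ι U) (f g : A)
    (hf : SetLike.IsHomogeneousElem 𝒜 f) (hg : SetLike.IsHomogeneousElem 𝒜 g) (hf0 : f ≠ 0)
    (hg0 : g ≠ 0) : f * g ≠ 0 := fun h => by
  have := congrArg Θ h
  rw [map_mul, map_zero] at this
  exact _root_.mul_ne_zero (hp.map_ne_zero_of_ne_zero hf hf0) (hp.map_ne_zero_of_ne_zero hg hg0)
    this

theorem mul_left_cancel (hp : IsGenericPoint 𝒜 w v Θ ι U) {f g h : A}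
    (hf : SetLike.IsHomogeneousElem 𝒜 f) (hg : SetLike.IsHomogeneousElem 𝒜 g)
    (hh : SetLike.IsHomogeneousElem 𝒜 h) (hf0 : f ≠ 0) (e : f * g = f * h) : g = h :=
  hp.isGrading.mul_left_cancel hp.mul_ne_zero hf hg hh hf0 e

theorem isHomogeneousElem (hp : IsGenericPoint 𝒜 w v Θ ι U) (y : σ) :
    SetLike.IsHomogeneousElem 𝒜 (v y) := ⟨_, hp.mem y⟩

theorem prod_pow_mem (hp : IsGenericPoint 𝒜 w v Θ ι U) (n : σ → ℕ) :
    ∏ y, v y ^ n y ∈ 𝒜 (Fintype.linearCombination ℤ w fun y => (n y : ℤ)) := by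
  rw [Fintype.linearCombination_apply]
  have := hp.isGrading.1
  simp only [natCast_zsmul]
  exact SetLike.prod_mem_graded 𝒜 _ _ fun y _ => SetLike.pow_mem_graded _ (hp.mem y)

theorem prod_pow_mem_closure (v : σ → A) (n : σ → ℕ) :
    ∏ y, v y ^ n y ∈ Submonoid.closure (Set.range v) :=
  prod_mem fun y _ => pow_mem (Submonoid.subset_closure (Set.mem_range_self y)) _

theorem isHomogeneousElem_of_mem_closure (hp : IsGenericPoint 𝒜 w v Θ ι U) {m : A}
    (hm : m ∈ Submonoid.closure (Set.range v)) : SetLike.IsHomogeneousElem 𝒜 m := by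
  induction hm using Submonoid.closure_induction with
  | mem x hx => obtain ⟨y, rfl⟩ := hx; exact hp.isHomogeneousElem y
  | one => exact hp.isGrading.isHomogeneousElem_one
  | mul x y _ _ hx hy => exact hp.isGrading.isHomogeneousElem_mul hx hy

theorem map_prod_pow (n : σ → ℕ) :
    Θ (∏ y, v y ^ n y) = laurentEval (Θ ∘ v) fun y => (n y : ℤ) := by
  simp [laurentEval_natCast, map_prod]

/-- If no `v y` divides `h`, then monomials in the `v y` are coprime to `h`. -/
theorem dvd_of_dvd_monomial_mul (hp : IsGenericPoint 𝒜 w v Θ ι U) {h : A}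
    (hh : SetLike.IsHomogeneousElem 𝒜 h) (hv : ∀ y, ¬ v y ∣ h) {m : A}
    (hm : m ∈ Submonoid.closure (Set.range v)) {a : A} (ha : SetLike.IsHomogeneousElem 𝒜 a)
    (hd : h ∣ m * a) : h ∣ a := by
  induction hm using Submonoid.closure_induction_left with
  | one => simpa using hd
  | mul_left x hx m hm ih =>
    obtain ⟨y, rfl⟩ := hx
    apply ih
    have hma := hp.isGrading.isHomogeneousElem_mul (hp.isHomogeneousElem_of_mem_closure hm) ha
    rw [mul_assoc] at hd
    obtain ⟨k, hk, e⟩ := hp.isGrading.exists_homogeneous_of_dvd hh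
      (hp.isGrading.isHomogeneousElem_mul (hp.isHomogeneousElem y) hma) hd
    rcases (hp.isGradedPrime y).2.2.2 h k hh hk ⟨_, e.symm⟩ with h' | h'
    · exact absurd h' (hv y)
    · obtain ⟨k', hk', rfl⟩ := hp.isGrading.exists_homogeneous_of_dvd (hp.isHomogeneousElem y) hk h'
      refine ⟨k', hp.mul_left_cancel (hp.isHomogeneousElem y) hma
        (hp.isGrading.isHomogeneousElem_mul hh hk') (hp.isGradedPrime y).2.1 ?_⟩
      rw [e]; ring

/-- A homogeneous divisor of a monomial in the `v y` is associated to such a monomial. -/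
theorem exists_factors_of_dvd_monomial (hp : IsGenericPoint 𝒜 w v Θ ι U) {m : A}
    (hm : m ∈ Submonoid.closure (Set.range v)) {f : A} (hf : SetLike.IsHomogeneousElem 𝒜 f)
    (hd : f ∣ m) : ∃ S : Multiset A, (∀ p ∈ S, IsGradedPrime 𝒜 p) ∧ Associated S.prod f := by
  induction hm using Submonoid.closure_induction_left generalizing f with
  | one => exact ⟨0, by simp, by simpa using (associated_one_iff_isUnit.mpr
      (isUnit_of_dvd_one hd)).symm⟩
  | mul_left x hx m hm ih =>
    obtain ⟨y, rfl⟩ := hx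
    have hmh := hp.isHomogeneousElem_of_mem_closure hm
    have hy := hp.isHomogeneousElem y
    obtain ⟨k, hk, e⟩ := hp.isGrading.exists_homogeneous_of_dvd hf
      (hp.isGrading.isHomogeneousElem_mul hy hmh) hd
    rcases (hp.isGradedPrime y).2.2.2 f k hf hk ⟨_, e.symm⟩ with h' | h'
    · obtain ⟨f', hf', rfl⟩ := hp.isGrading.exists_homogeneous_of_dvd hy hf h'
      obtain ⟨S, hS, hSf⟩ := ih hf' ⟨k, hp.mul_left_cancel hy hmh
        (hp.isGrading.isHomogeneousElem_mul hf' hk) (hp.isGradedPrime y).2.1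
        (by rw [e, mul_assoc])⟩
      refine ⟨v y ::ₘ S, ?_, by rw [Multiset.prod_cons]; exact hSf.mul_left _⟩
      intro p hpS
      rcases Multiset.mem_cons.mp hpS with rfl | hpS
      · exact hp.isGradedPrime y
      · exact hS p hpS
    · obtain ⟨k', hk', rfl⟩ := hp.isGrading.exists_homogeneous_of_dvd hy hk h'
      exact ih hf ⟨k', hp.mul_left_cancel hy hmh
        (hp.isGrading.isHomogeneousElem_mul hf hk') (hp.isGradedPrime y).2.1
        (by rw [e]; ring)⟩

end IsGenericPoint

namespace Represents

variable {f g : A} {c c' : C}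

theorem isHomogeneousElem (hf : Represents 𝒜 w v Θ ι f c) : SetLike.IsHomogeneousElem 𝒜 f := by
  obtain ⟨x, _, h, _⟩ := hf
  exact ⟨_, h⟩

theorem one (hp : IsGenericPoint 𝒜 w v Θ ι U) : Represents 𝒜 w v Θ ι 1 1 :=
  ⟨0, 1, by simpa using hp.isGrading.one_mem, by simp [laurentEval_zero]⟩

theorem mul_unit (hf : Represents 𝒜 w v Θ ι f c) (ε : Cˣ) : Represents 𝒜 w v Θ ι f (c * ε) := by
  obtain ⟨x, η, h, e⟩ := hf
  refine ⟨x, η * ε⁻¹, h, ?_⟩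
  rw [e, Units.val_mul, mul_assoc, mul_comm c, Units.inv_mul_cancel_left]

theorem of_associated (hf : Represents 𝒜 w v Θ ι f c) (h : Associated c c') :
    Represents 𝒜 w v Θ ι f c' := by
  obtain ⟨ε, rfl⟩ := h
  exact hf.mul_unit ε

theorem exists_of_ne_zero (hp : IsGenericPoint 𝒜 w v Θ ι U)
    (hf : SetLike.IsHomogeneousElem 𝒜 f) (hf0 : f ≠ 0) :
    ∃ c ≠ 0, Represents 𝒜 w v Θ ι f c := by
  obtain ⟨k, hk⟩ := id hf
  obtain ⟨x, c, rfl, e⟩ := hp.exists_rep k f hk hf0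
  refine ⟨c, ?_, x, 1, hk, by simpa using e⟩
  rintro rfl
  exact hp.map_ne_zero_of_ne_zero hf hf0 (by rw [e, map_zero, mul_zero])

theorem exists_lift (hp : IsGenericPoint 𝒜 w v Θ ι U) (hc : c ≠ 0) :
    ∃ h ≠ 0, Represents 𝒜 w v Θ ι h c := by
  obtain ⟨x, h, hx, e⟩ := hp.exists_lift c
  refine ⟨h, ?_, x, 1, hx, by simpa using e⟩
  rintro rfl
  rw [map_zero] at e
  exact mul_ne_zero (hp.map_laurentEval_ne_zero x)
    ((map_ne_zero_iff ι hp.injective).mpr hc) e.symm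

theorem of_mul_mem (hp : IsGenericPoint 𝒜 w v Θ ι U) {u : C} (hu : u ∈ U)
    (hf : Represents 𝒜 w v Θ ι f (u * c)) : Represents 𝒜 w v Θ ι f c := by
  obtain ⟨x, ε, hx, e⟩ := hf
  obtain ⟨x', hx', e'⟩ := hp.exists_of_mem u hu
  refine ⟨x + x', ε, by rwa [map_add, hx', add_zero], ?_⟩
  rw [e, laurentEval_add hp.comp_ne_zero, e', ← mul_assoc (ε : C), mul_comm (ε : C) u, mul_assoc u,
    map_mul ι u, mul_assoc]

theorem mul (hp : IsGenericPoint 𝒜 w v Θ ι U) (hf : Represents 𝒜 w v Θ ι f c)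
    (hg : Represents 𝒜 w v Θ ι g c') : Represents 𝒜 w v Θ ι (f * g) (c * c') := by
  obtain ⟨x, ε, hx, e⟩ := hf
  obtain ⟨x', ε', hx', e'⟩ := hg
  refine ⟨x + x', ε * ε', by rw [map_add]; exact hp.isGrading.mem_mul hx hx', ?_⟩
  rw [map_mul, e, e', laurentEval_add hp.comp_ne_zero, Units.val_mul]
  simp only [map_mul]
  ring

theorem of_dvd (hp : IsGenericPoint 𝒜 w v Θ ι U) (hg : Represents 𝒜 w v Θ ι g (c * c'))
    (hf : Represents 𝒜 w v Θ ι f c) (hf0 : f ≠ 0) (hd : f ∣ g) :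
    ∃ k, g = f * k ∧ Represents 𝒜 w v Θ ι k c' := by
  have hΘ := hp.map_ne_zero_of_ne_zero hf.isHomogeneousElem hf0
  obtain ⟨x, ε, hx, e⟩ := hf
  obtain ⟨x', ε', hx', e'⟩ := hg
  obtain ⟨k, hk, rfl⟩ := hp.isGrading.exists_mem_of_dvd hx hx' hd
  refine ⟨k, rfl, x' - x, ε' * ε⁻¹, by rwa [map_sub], ?_⟩
  apply mul_left_cancel₀ hΘ
  rw [← map_mul, e', e, laurentEval_sub hp.comp_ne_zero]
  have h1 := hp.map_laurentEval_ne_zero x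
  have h2 : (ε' * (c * c') : C) = ε * c * ((ε' * ε⁻¹ : Cˣ) * c') := by
    rw [Units.val_mul]
    calc (ε' * (c * c') : C) = ε' * (c * c') * (ε * (ε⁻¹ : Cˣ)) := by simp
      _ = _ := by ring
  rw [h2]
  simp only [map_mul]
  field_simp

theorem exists_associated (hp : IsGenericPoint 𝒜 w v Θ ι U) (hf : Represents 𝒜 w v Θ ι f c)
    (hf' : Represents 𝒜 w v Θ ι f c') (hf0 : f ≠ 0) :
    ∃ u ∈ Submonoid.closure U, ∃ u' ∈ Submonoid.closure U, Associated (u * c) (u' * c') := by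
  obtain ⟨x, ε, hx, e⟩ := hf
  obtain ⟨x', ε', hx', e'⟩ := hf'
  have hxx := hp.isGrading.eq_of_mem_of_mem hx' hx hf0
  obtain ⟨u', hu', u, hu, h⟩ := hp.exists_closure (x' - x) (by rw [map_sub, hxx, sub_self])
  refine ⟨u', hu', u, hu, ε * ε'⁻¹, ?_⟩
  have h1 := hp.map_laurentEval_ne_zero x
  have key : ι (u' * (ε * c)) = ι (u * (ε' * c')) := by
    apply mul_left_cancel₀ h1
    rw [map_mul, map_mul ι u, ← h, laurentEval_sub hp.comp_ne_zero]
    rw [e] at e'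
    field_simp
    linear_combination (ι u') * e'
  have := hp.injective key
  rw [Units.val_mul]
  calc u' * c * (ε * (ε'⁻¹ : Cˣ)) = u' * (ε * c) * (ε'⁻¹ : Cˣ) := by ring
    _ = u * c' * (ε' * (ε'⁻¹ : Cˣ)) := by rw [this]; ring
    _ = u * c' := by simp

/-- Divisibility of representatives lifts to divisibility up to monomials. -/
theorem dvd_monomial_mul (hp : IsGenericPoint 𝒜 w v Θ ι U) (hf : Represents 𝒜 w v Θ ι f c)
    (hg : Represents 𝒜 w v Θ ι g (c * c')) :
    ∃ m ∈ Submonoid.closure (Set.range v), f ∣ m * g := by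
  obtain ⟨z, h, hz, eh⟩ := hp.exists_lift c'
  have hfh : Represents 𝒜 w v Θ ι (f * h) (c * c') := mul hp hf ⟨z, 1, hz, by simpa using eh⟩
  obtain ⟨x, ε, hx, e⟩ := hfh
  obtain ⟨x', ε', hx', e'⟩ := hg
  obtain ⟨a, ha, hau, ea⟩ := hp.exists_unit ε
  obtain ⟨a', ha', hau', ea'⟩ := hp.exists_unit ε'
  -- The exponent vectors of the two monomials are the positive and negative parts of `x' - x`.
  set p : σ → ℕ := fun y => (x' y - x y).toNat with hpdef
  set q : σ → ℕ := fun y => (x y - x' y).toNat with hqdef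
  have hpq : x + (fun y => (p y : ℤ)) = x' + fun y => (q y : ℤ) := by
    funext y
    simp only [Pi.add_apply, hpdef, hqdef]
    omega
  have key : (∏ y, v y ^ p y) * (f * h) * a' = (∏ y, v y ^ q y) * g * a := by
    refine hp.eq_of_map_eq (k := Fintype.linearCombination ℤ w (x + fun y => (p y : ℤ))) ?_ ?_ ?_
    · have := hp.isGrading.mem_mul (hp.isGrading.mem_mul (hp.prod_pow_mem p) hx) ha'
      rwa [add_zero, ← map_add, add_comm] at this
    · have := hp.isGrading.mem_mul (hp.isGrading.mem_mul (hp.prod_pow_mem q) hx') ha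
      rw [hpq]
      rwa [add_zero, ← map_add, add_comm] at this
    · have := congrArg (laurentEval (Θ ∘ v)) hpq
      rw [laurentEval_add hp.comp_ne_zero, laurentEval_add hp.comp_ne_zero] at this
      rw [map_mul, map_mul _ _ (f * h), map_mul _ _ a, map_mul _ _ g, e, e', ea, ea',
          IsGenericPoint.map_prod_pow,
        IsGenericPoint.map_prod_pow]
      simp only [map_mul]
      linear_combination ι ε * ι c * ι c' * ι ε' * this
  refine ⟨_, IsGenericPoint.prod_pow_mem_closure v q, ?_⟩
  have hd : f ∣ (∏ y, v y ^ q y) * g * a := by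
    rw [← key]
    exact ⟨(∏ y, v y ^ p y) * h * a', by ring⟩
  exact (hau.dvd_mul_right).mp hd

/-- Some element represented by `c` is divisible by none of the `v y`. -/
theorem exists_lift_not_dvd [IsNoetherianRing A] (hp : IsGenericPoint 𝒜 w v Θ ι U) (hc : c ≠ 0) :
    ∃ h ≠ 0, Represents 𝒜 w v Θ ι h c ∧ ∀ y, ¬ v y ∣ h := by
  obtain ⟨h, h0, hh⟩ := exists_lift hp hc
  obtain ⟨I, ⟨h, ⟨h0, hh⟩, rfl⟩, hmax⟩ := set_has_maximal_iff_noetherian.mpr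
    (inferInstanceAs (IsNoetherian A A))
    ((fun h => Ideal.span {h}) '' {h | h ≠ 0 ∧ Represents 𝒜 w v Θ ι h c}) ⟨_, h, ⟨h0, hh⟩, rfl⟩
  -- Otherwise dividing `h` by `v y` would enlarge the ideal, which was chosen maximal.
  refine ⟨h, h0, hh, fun y hy => ?_⟩
  have hyh := hp.isHomogeneousElem y
  have hv : Represents 𝒜 w v Θ ι (v y) 1 := by
    classical
    refine ⟨Pi.single y 1, 1, ?_, ?_⟩
    · rw [Fintype.linearCombination_apply_single, one_smul]
      exact hp.mem y
    · simp [laurentEval, Pi.single_apply, apply_ite]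
  obtain ⟨k, rfl, hk⟩ := of_dvd hp (by rwa [one_mul]) hv (hp.isGradedPrime y).2.1 hy
  have hk0 : k ≠ 0 := right_ne_zero_of_mul h0
  refine hmax _ ⟨k, ⟨hk0, hk⟩, rfl⟩ (lt_of_le_not_ge ?_ ?_)
  · exact Ideal.span_singleton_le_span_singleton.mpr (dvd_mul_left k (v y))
  · intro hle
    obtain ⟨a, ha, e⟩ := hp.isGrading.exists_homogeneous_of_dvd hh.isHomogeneousElem
      hk.isHomogeneousElem (Ideal.span_singleton_le_span_singleton.mp hle)
    refine (hp.isGradedPrime y).2.2.1 (IsUnit.of_mul_eq_one a ?_)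
    refine hp.mul_left_cancel hk.isHomogeneousElem (hp.isGrading.isHomogeneousElem_mul hyh ha)
      hp.isGrading.isHomogeneousElem_one hk0 ?_
    rw [mul_one, ← mul_assoc, mul_comm k, ← e]

end Represents

namespace IsGenericPoint

theorem exists_dvd_of_dvd_closure {π u : C} (hπ : Prime π) (hu : u ∈ Submonoid.closure U)
    (hd : π ∣ u) : ∃ u ∈ U, π ∣ u := by
  induction hu using Submonoid.closure_induction with
  | mem x hx => exact ⟨x, hx, hd⟩
  | one => exact absurd (isUnit_of_dvd_one hd) hπ.not_isUnit
  | mul x y _ _ hx hy => exact (hπ.dvd_or_dvd hd).elim hx hy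

/-- An element without monomial factors that is represented by a prime outside `U` is a graded
prime. -/
theorem isGradedPrime_of_represents (hp : IsGenericPoint 𝒜 w v Θ ι U) {h : A} {π : C}
    (hπ : Prime π) (hU : ∀ u ∈ U, ¬ π ∣ u) (h0 : h ≠ 0) (hh : Represents 𝒜 w v Θ ι h π)
    (hv : ∀ y, ¬ v y ∣ h) : IsGradedPrime 𝒜 h := by
  have hU' : ∀ u ∈ Submonoid.closure U, ¬ π ∣ u := fun u hu hd => by
    obtain ⟨u, hu, hd⟩ := exists_dvd_of_dvd_closure hπ hu hd
    exact hU u hu hd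
  refine ⟨hh.isHomogeneousElem, h0, fun hu => ?_, fun f g hf hg hd => ?_⟩
  · obtain ⟨k, hk, e⟩ := hp.isGrading.exists_homogeneous_of_dvd hh.isHomogeneousElem
      hp.isGrading.isHomogeneousElem_one hu.dvd
    have hk0 : k ≠ 0 := by
      rintro rfl
      exact hp.one_ne_zero (by simpa using e)
    obtain ⟨c, -, hc⟩ := Represents.exists_of_ne_zero hp hk hk0
    have := Represents.mul hp hh hc
    rw [← e] at this
    obtain ⟨u, hu, u', hu', has⟩ := Represents.exists_associated hp (Represents.one hp) this
      hp.one_ne_zero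
    exact hU' u hu ((dvd_mul_of_dvd_right (dvd_mul_right π c) u').trans
      (has.symm.dvd.trans (by rw [mul_one])))
  · by_cases hf0 : f = 0
    · exact Or.inl (hf0 ▸ dvd_zero h)
    by_cases hg0 : g = 0
    · exact Or.inr (hg0 ▸ dvd_zero h)
    obtain ⟨k, hk, e⟩ := hp.isGrading.exists_homogeneous_of_dvd hh.isHomogeneousElem
      (hp.isGrading.isHomogeneousElem_mul hf hg) hd
    have hfg0 := hp.mul_ne_zero f g hf hg hf0 hg0
    have hk0 : k ≠ 0 := by
      rintro rfl
      exact hfg0 (by simpa using e)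
    obtain ⟨c, -, hc⟩ := Represents.exists_of_ne_zero hp hk hk0
    obtain ⟨a, -, ha⟩ := Represents.exists_of_ne_zero hp hf hf0
    obtain ⟨b, -, hb⟩ := Represents.exists_of_ne_zero hp hg hg0
    have h1 := Represents.mul hp hh hc
    rw [← e] at h1
    obtain ⟨u, hu, u', hu', has⟩ := Represents.exists_associated hp h1
      (Represents.mul hp ha hb) hfg0
    have hd' : π ∣ u' * (a * b) :=
      (dvd_mul_of_dvd_right (dvd_mul_right π c) u).trans has.dvd
    have lift : ∀ {f : A} {a : C}, Represents 𝒜 w v Θ ι f a → π ∣ a → h ∣ f := by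
      rintro f _ hf ⟨a', rfl⟩
      obtain ⟨m, hm, hd⟩ := Represents.dvd_monomial_mul hp hh hf
      exact hp.dvd_of_dvd_monomial_mul hh.isHomogeneousElem hv hm hf.isHomogeneousElem hd
    exact (hπ.dvd_or_dvd ((hπ.dvd_or_dvd hd').resolve_left (hU' u' hu'))).imp (lift ha) (lift hb)

variable [IsDomain C] [UniqueFactorizationMonoid C]

/-- Induction on the number of prime factors of a representative: a prime in `U` is moved into the
Laurent monomial, any other prime is split off as a graded prime. -/
theorem exists_gradedPrime_factors_of_represents [IsNoetherianRing A]
    (hp : IsGenericPoint 𝒜 w v Θ ι U) (c : C) :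
    ∀ f : A, f ≠ 0 → c ≠ 0 → Represents 𝒜 w v Θ ι f c →
      ∃ S : Multiset A, (∀ p ∈ S, IsGradedPrime 𝒜 p) ∧ Associated S.prod f := by
  induction c using UniqueFactorizationMonoid.induction_on_prime with
  | h₁ => exact fun f _ h => absurd rfl h
  | h₂ c hc =>
    intro f hf0 _ hf
    obtain ⟨m, hm, hd⟩ := Represents.dvd_monomial_mul hp (c' := ((hc.unit⁻¹ : Cˣ) : C)) hf
      (by simpa using Represents.one hp)
    exact hp.exists_factors_of_dvd_monomial hm hf.isHomogeneousElem (by simpa using hd)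
  | h₃ c π hc0 hπ ih =>
    intro f hf0 _ hf
    by_cases hU : ∃ u ∈ U, π ∣ u
    · obtain ⟨u, hu, hd⟩ := hU
      have has : Associated π u := hπ.associated_of_dvd (hp.prime_of_mem u hu) hd
      exact ih f hf0 hc0 (Represents.of_mul_mem hp hu (hf.of_associated (has.mul_right c)))
    · push Not at hU
      obtain ⟨h, h0, hh, hv⟩ := Represents.exists_lift_not_dvd hp hπ.ne_zero
      have hprime := hp.isGradedPrime_of_represents hπ hU h0 hh hv
      obtain ⟨m, hm, hd⟩ := Represents.dvd_monomial_mul hp hh hf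
      obtain ⟨k, rfl, hk⟩ := Represents.of_dvd hp hf hh h0
        (hp.dvd_of_dvd_monomial_mul hh.isHomogeneousElem hv hm hf.isHomogeneousElem hd)
      obtain ⟨S, hS, hSk⟩ := ih k (right_ne_zero_of_mul hf0) hc0 hk
      refine ⟨h ::ₘ S, ?_, by rw [Multiset.prod_cons]; exact hSk.mul_left _⟩
      intro p hpS
      rcases Multiset.mem_cons.mp hpS with rfl | hpS
      · exact hprime
      · exact hS p hpS

theorem isFactorialGrading [IsNoetherianRing A] (hp : IsGenericPoint 𝒜 w v Θ ι U) :
    IsFactorialGrading 𝒜 := by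
  refine isFactorialGrading_of_exists_gradedPrime_factors hp.isGrading hp.one_ne_zero
    hp.mul_ne_zero fun f hf hf0 => ?_
  obtain ⟨c, hc0, hc⟩ := Represents.exists_of_ne_zero hp hf hf0
  exact hp.exists_gradedPrime_factors_of_represents c f hf0 hc0 hc

/-- A representative dividing a product of elements of `U` may be replaced by `1`. -/
theorem represents_one_of_dvd_closure (hp : IsGenericPoint 𝒜 w v Θ ι U) (c : C) :
    ∀ f : A, (∃ u ∈ Submonoid.closure U, c ∣ u) → Represents 𝒜 w v Θ ι f c →
      Represents 𝒜 w v Θ ι f 1 := by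
  have hne : ∀ u ∈ Submonoid.closure U, u ≠ 0 := fun u hu => by
    induction hu using Submonoid.closure_induction with
    | mem x hx => exact (hp.prime_of_mem x hx).ne_zero
    | one => exact _root_.one_ne_zero
    | mul x y _ _ hx hy => exact _root_.mul_ne_zero hx hy
  induction c using UniqueFactorizationMonoid.induction_on_prime with
  | h₁ =>
    rintro f ⟨u, hu, hd⟩ _
    exact absurd (zero_dvd_iff.mp hd) (hne u hu)
  | h₂ c hc => exact fun f _ hf => hf.of_associated (associated_one_iff_isUnit.mpr hc)
  | h₃ c π hc0 hπ ih =>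
    rintro f ⟨u, hu, hd⟩ hf
    obtain ⟨u', hu', hd'⟩ := exists_dvd_of_dvd_closure hπ hu ((dvd_mul_right π c).trans hd)
    have has : Associated π u' := hπ.associated_of_dvd (hp.prime_of_mem u' hu') hd'
    exact ih f ⟨u, hu, (dvd_mul_left c π).trans hd⟩
      (Represents.of_mul_mem hp hu' (hf.of_associated (has.mul_right c)))

/-- Homogeneous units have degree zero and are constants: a monomial factor in numerator or
denominator is excluded since the `v y` are pairwise coprime graded primes. -/
theorem exists_unit_of_isUnit (hp : IsGenericPoint 𝒜 w v Θ ι U) {f : A}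
    (hf : SetLike.IsHomogeneousElem 𝒜 f) (hu : IsUnit f) :
    f ∈ 𝒜 0 ∧ ∃ ε : Cˣ, Θ f = ι ε := by
  have hf0 : f ≠ 0 := by
    rintro rfl
    exact hp.one_ne_zero (isUnit_zero_iff.mp hu).symm
  obtain ⟨g, hg, e⟩ := hp.isGrading.exists_homogeneous_of_dvd hf
    hp.isGrading.isHomogeneousElem_one hu.dvd
  have hg0 : g ≠ 0 := by
    rintro rfl
    exact hp.one_ne_zero (by simpa using e)
  obtain ⟨c, -, hc⟩ := Represents.exists_of_ne_zero hp hf hf0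
  obtain ⟨c', -, hc'⟩ := Represents.exists_of_ne_zero hp hg hg0
  have h1 := Represents.mul hp hc hc'
  rw [← e] at h1
  obtain ⟨u, hu', u', -, has⟩ := Represents.exists_associated hp (Represents.one hp) h1
    hp.one_ne_zero
  have hcu : c ∣ u := (dvd_mul_of_dvd_right (dvd_mul_right c c') u').trans
    (has.symm.dvd.trans (by rw [mul_one]))
  obtain ⟨x, ε, hx, ex⟩ := hp.represents_one_of_dvd_closure c f ⟨u, hu', hcu⟩ hc
  rw [mul_one] at ex
  obtain ⟨a, ha, hau, ea⟩ := hp.exists_unit ε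
  -- `f` is, up to a constant, the quotient of the monomials of the positive and the negative part
  -- of `x`.
  set p : σ → ℕ := fun y => (x y).toNat with hpdef
  set q : σ → ℕ := fun y => (- x y).toNat with hqdef
  have hpq : (fun y => (p y : ℤ)) = x + fun y => (q y : ℤ) := by
    funext y
    simp only [Pi.add_apply, hpdef, hqdef]
    omega
  have key : (∏ y, v y ^ p y) * a = (∏ y, v y ^ q y) * f := by
    refine hp.eq_of_map_eq (k := Fintype.linearCombination ℤ w fun y => (p y : ℤ)) ?_ ?_ ?_
    · simpa using hp.isGrading.mem_mul (hp.prod_pow_mem p) ha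
    · have := hp.isGrading.mem_mul (hp.prod_pow_mem q) hx
      rwa [← map_add, add_comm, ← hpq] at this
    · rw [map_mul, map_mul, map_prod_pow, map_prod_pow, ex, ea, hpq,
          laurentEval_add hp.comp_ne_zero]
      ring
  -- Only monomials that involve `v y` are divisible by it.
  have aux : ∀ y, ∀ n : σ → ℕ, v y ∣ ∏ z, v z ^ n z → n y ≠ 0 := by
    intro y n hd hn
    have hgp := hp.isGradedPrime y
    have := hp.isGrading.1
    have step : ∀ s : Finset σ, ¬ v y ∣ ∏ z ∈ s, v z ^ n z := by
      classical
      have hpow : ∀ z k, SetLike.IsHomogeneousElem 𝒜 (v z ^ k) := fun z k =>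
        ⟨_, SetLike.pow_mem_graded k (hp.mem z)⟩
      intro s
      induction s using Finset.induction_on with
      | empty => exact fun h => hgp.2.2.1 (isUnit_of_dvd_one (by simpa using h))
      | insert z s hz ih =>
        intro h
        rw [Finset.prod_insert hz] at h
        rcases hgp.2.2.2 _ _ (hpow z _) ⟨_, SetLike.prod_mem_graded 𝒜 _ _ fun z _ =>
          SetLike.pow_mem_graded _ (hp.mem z)⟩ h with h | h
        · have hpw : ∀ k, (z = y → k = 0) → ¬ v y ∣ v z ^ k := by
            intro k
            induction k with
            | zero => exact fun _ h => hgp.2.2.1 (isUnit_of_dvd_one (by simpa using h))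
            | succ k ihk =>
              intro hk h
              have hzy : y ≠ z := fun h => by simpa using hk h.symm
              rw [pow_succ] at h
              rcases hgp.2.2.2 _ _ (hpow z k) (hp.isHomogeneousElem z) h with h | h
              · exact ihk (fun h => absurd h.symm hzy) h
              · exact hp.not_dvd y z hzy h
          exact hpw _ (fun h => h ▸ hn) h
        · exact ih h
    exact step _ hd
  have hx0 : x = 0 := by
    funext y
    by_contra hne
    rcases lt_or_gt_of_ne hne with h | h
    · have hq : q y ≠ 0 := by simp only [hqdef, Pi.zero_apply] at *; omega
      refine aux y p ?_ ?_
      · rw [← hau.dvd_mul_right, key]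
        exact dvd_mul_of_dvd_left ((dvd_pow_self _ hq).trans
          (Finset.dvd_prod_of_mem (fun z => v z ^ _) (Finset.mem_univ y))) _
      · simp only [hpdef, Pi.zero_apply] at *; omega
    · have hq : p y ≠ 0 := by simp only [hpdef, Pi.zero_apply] at *; omega
      refine aux y q ?_ ?_
      · rw [← hu.dvd_mul_right, ← key]
        exact dvd_mul_of_dvd_left ((dvd_pow_self _ hq).trans
          (Finset.dvd_prod_of_mem (fun z => v z ^ _) (Finset.mem_univ y))) _
      · simp only [hqdef, Pi.zero_apply] at *; omega
  subst hx0
  exact ⟨by simpa using hx, ε, by simpa [laurentEval_zero] using ex⟩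

end IsGenericPoint
end Nagata

/-! ### Gradings of quotients of polynomial rings -/

section QuotientGrading

variable {𝕂 K σ : Type*} [CommRing 𝕂] [AddCommGroup K]

/-- The components of the quotient of a polynomial ring, graded by the weights `w` of the variables,
by an ideal `I`: the classes of the weighted homogeneous polynomials. -/
noncomputable def quotientGrading (w : σ → K) (I : Ideal (MvPolynomial σ 𝕂)) (k : K) :
    Submodule 𝕂 (MvPolynomial σ 𝕂 ⧸ I) :=
  (weightedHomogeneousSubmodule 𝕂 w k).map (Ideal.Quotient.mkₐ 𝕂 I).toLinearMap

theorem mem_quotientGrading {w : σ → K} {I : Ideal (MvPolynomial σ 𝕂)} {k : K}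
    {f : MvPolynomial σ 𝕂 ⧸ I} : f ∈ quotientGrading w I k ↔
      ∃ p, IsWeightedHomogeneous w p k ∧ Ideal.Quotient.mk I p = f :=
  Iff.rfl

theorem isGrading_quotientGrading (w : σ → K) (S : Set (MvPolynomial σ 𝕂))
    (hS : ∀ g ∈ S, ∃ k, IsWeightedHomogeneous w g k) :
    IsGrading (quotientGrading w (Ideal.span S)) := by
  classical
  let _ := weightedGradedAlgebra 𝕂 w
  have hI : (Ideal.span S).IsHomogeneous (weightedHomogeneousSubmodule 𝕂 w) :=
    Ideal.homogeneous_span _ _ fun g hg => hS g hg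
  refine ⟨{ one_mem := ⟨1, isWeightedHomogeneous_one 𝕂 w, map_one (Ideal.Quotient.mk _)⟩,
             mul_mem := ?_ }, ?_, ?_⟩
  · rintro i j _ _ ⟨p, hp, rfl⟩ ⟨q, hq, rfl⟩
    exact ⟨p * q, IsWeightedHomogeneous.mul hp hq, map_mul (Ideal.Quotient.mk _) p q⟩
  · rw [injective_iff_map_eq_zero]
    intro x hx
    choose p hp hpx using fun i => mem_quotientGrading.mp (x i).2
    have h0 : ∑ i ∈ DFinsupp.support x, p i ∈ Ideal.span S := by
      rw [← Ideal.Quotient.eq_zero_iff_mem, map_sum, ← hx]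
      simp only [hpx]
      exact (DirectSum.coeAddMonoidHom_eq_dfinsuppSum _ x).symm
    ext i
    by_cases hi : i ∈ DFinsupp.support x
    · have := weightedHomogeneousComponent_mem_of_mem 𝕂 w hI h0 i
      rw [map_sum, Finset.sum_eq_single i, (hp i).weightedHomogeneousComponent_same] at this
      · rw [← hpx i]
        exact Ideal.Quotient.eq_zero_iff_mem.mpr this
      · exact fun j _ hji => (hp j).weightedHomogeneousComponent_ne i hji.symm
      · exact fun h => absurd hi h
    · have : x i = 0 := by simpa using hi
      simp [this]
  · intro f
    obtain ⟨p, rfl⟩ := Ideal.Quotient.mk_surjective f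
    induction p using MvPolynomial.induction_on' with
    | monomial e c =>
      exact ⟨DirectSum.of (fun k => quotientGrading w (Ideal.span S) k) (Finsupp.weight w e)
        ⟨_, _, isWeightedHomogeneous_monomial w e c rfl, rfl⟩, by simp⟩
    | add p q hp hq =>
      obtain ⟨x, hx⟩ := hp
      obtain ⟨y, hy⟩ := hq
      exact ⟨x + y, by rw [map_add, hx, hy, map_add]⟩

end QuotientGrading

/-! ### Trinomial data and their torus points -/

section Trinomial

/-- Data of a trinomial algebra with normalized coefficients: the variables with `blk y = some t`
form block `t`, with exponents `l y`; those with `blk y = none` are free. The scalars `δ t`, `β t`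
express the monomial of block `t` by those of the blocks `0` and `1`. Blocks may be empty, so that
inhomogeneous relations are covered by an empty block `0`, whose monomial is `1`. -/
structure Trinomial (𝕂 : Type*) [Field 𝕂] (r : ℕ) (σ : Type*) where
  blk : σ → Option (Fin (r + 1))
  l : σ → ℕ
  l_pos : ∀ y, 0 < l y
  δ : Fin (r + 1) → 𝕂
  β : Fin (r + 1) → 𝕂
  δ_zero : δ 0 = 1
  β_zero : β 0 = 0
  δ_one : δ 1 = 0
  β_one : β 1 = 1
  minor_ne_zero : ∀ i t, i ≠ t → δ i * β t - β i * δ t ≠ 0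

namespace Trinomial

variable {𝕂 σ : Type*} [Field 𝕂] {r s : ℕ} (T : Trinomial 𝕂 r σ)

/-- The exponent vector of the monomial of block `t`. -/
def expo (t : Fin (r + 1)) (y : σ) : ℕ := if T.blk y = some t then T.l y else 0

theorem expo_of_blk {t : Fin (r + 1)} {y : σ} (h : T.blk y = some t) : T.expo t y = T.l y :=
  if_pos h

theorem sum_mul_expo_of_blk {M : Type*} [CommSemiring M] (κ : Fin (r + 1) → M) {t : Fin (r + 1)}
    {y : σ} (h : T.blk y = some t) : ∑ t', κ t' * (T.expo t' y : M) = κ t * T.l y := by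
  rw [Finset.sum_eq_single t, T.expo_of_blk h]
  · intro t' _ hne
    have : T.blk y ≠ some t' := by
      rw [h]
      simpa using hne.symm
    simp [expo, this]
  · simp

theorem sum_mul_expo_of_blk_none {M : Type*} [CommSemiring M] (κ : Fin (r + 1) → M) {y : σ}
    (h : T.blk y = none) : ∑ t', κ t' * (T.expo t' y : M) = 0 :=
  Finset.sum_eq_zero fun t _ => by simp [expo, h]

/-- The exponent vector combined from those of the blocks, with coefficients `κ`, and from the rows
of `d`, with coefficients `D`. -/
def combination (d : Fin s → σ → ℤ) (κ : Fin (r + 1) → ℤ) (D : Fin s → ℤ) : σ → ℤ := fun y =>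
  (∑ t, κ t * (T.expo t y : ℤ)) + ∑ k, D k * d k y

theorem combination_add (d : Fin s → σ → ℤ) (κ κ' : Fin (r + 1) → ℤ) (D D' : Fin s → ℤ) :
    T.combination d (κ + κ') (D + D') = T.combination d κ D + T.combination d κ' D' := by
  funext y
  simp only [combination, Pi.add_apply, add_mul, Finset.sum_add_distrib]
  ring

theorem combination_zero (d : Fin s → σ → ℤ) : T.combination d 0 0 = 0 := by
  funext y
  simp [combination]

theorem combination_single_sub_single (d : Fin s → σ → ℤ) (t : Fin (r + 1)) :
    T.combination d (Pi.single t 1 - Pi.single 0 1) 0 =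
      (fun y => (T.expo t y : ℤ)) - fun y => (T.expo 0 y : ℤ) := by
  funext y
  simp [combination, sub_mul, Finset.sum_sub_distrib, Pi.single_apply]

/-- Compatibility of a grading with the trinomial data: the exponent vectors of degree zero are
the combinations of the differences of the block exponents and of the rows of `d`, and these
generators are linearly independent. -/
structure IsGradedBy [Fintype σ] {K : Type*} [AddCommGroup K] (w : σ → K) (d : Fin s → σ → ℤ) :
    Prop where
  eq_zero_iff : ∀ x, Fintype.linearCombination ℤ w x = 0 ↔
    ∃ κ D, ∑ t, κ t = 0 ∧ x = T.combination d κ D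
  injective : ∀ κ D, ∑ t, κ t = 0 → T.combination d κ D = 0 → κ = 0 ∧ D = 0

end Trinomial

/-- The units of an algebraically closed field form a divisible group. -/
theorem baer_additive_units (F : Type*) [Field F] [IsAlgClosed F] :
    Module.Baer ℤ (Additive Fˣ) := by
  have h : ∀ {n : ℕ}, n ≠ 0 → Function.Surjective fun a : Fˣ => a ^ n := by
    intro n hn a
    obtain ⟨z, hz⟩ := IsAlgClosed.exists_pow_nat_eq (a : F) (Nat.pos_of_ne_zero hn)
    have hz0 : z ≠ 0 := by
      rintro rfl
      exact a.ne_zero (by rw [← hz, zero_pow hn])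
    exact ⟨Units.mk0 z hz0, Units.ext (by simpa using hz)⟩
  let _ : RootableBy Fˣ ℕ := rootableByOfPowLeftSurj Fˣ ℕ h
  let _ : RootableBy Fˣ ℤ := Group.rootableByIntOfRootableByNat Fˣ
  let _ : DivisibleBy (Additive Fˣ) ℤ :=
    { div := fun a n => Additive.ofMul (RootableBy.root a.toMul n)
      div_zero := fun a => congrArg Additive.ofMul (RootableBy.root_zero (α := ℤ) a.toMul)
      div_cancel := fun a hn => congrArg Additive.ofMul (RootableBy.root_cancel a.toMul hn) }
  exact Module.Baer.of_divisible (Additive Fˣ)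

/-- A homomorphism from an additive group to `Fˣ`, defined along an embedding into `ℤ^σ`, is given
by evaluation of Laurent monomials at some point of the torus. -/
theorem exists_laurentEval_eq {σ F N : Type*} [Fintype σ] [Field F] [IsAlgClosed F]
    [AddCommGroup N] (f : N →+ (σ → ℤ)) (hf : Function.Injective f) (g : N →+ Additive Fˣ) :
    ∃ th : σ → F, (∀ y, th y ≠ 0) ∧ ∀ a, laurentEval th (f a) = ((g a).toMul : Fˣ) := by
  classical
  obtain ⟨h, hh⟩ := (baer_additive_units F).extension_property_addMonoidHom f hf g
  refine ⟨fun y => ((h (Pi.single y 1)).toMul : Fˣ), fun y => Units.ne_zero _, fun a => ?_⟩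
  rw [← hh, AddMonoidHom.comp_apply]
  generalize f a = x
  have hx : x = ∑ y, x y • Pi.single y (1 : ℤ) := by
    funext z
    simp [Finset.sum_apply, Pi.single_apply]
  conv_rhs => rw [hx]
  rw [map_sum]
  simp only [map_zsmul, toMul_sum, toMul_zsmul, laurentEval]
  push_cast
  rfl

namespace Trinomial

variable {𝕂 σ : Type*} [Field 𝕂] {r s : ℕ} {T : Trinomial 𝕂 r σ} [Fintype σ] {K : Type*}
  [AddCommGroup K] {w : σ → K} {d : Fin s → σ → ℤ}

theorem IsGradedBy.exists_point (h : T.IsGradedBy w d) {F : Type*} [Field F] [IsAlgClosed F]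
    (b : Fin (r + 1) → F) (hb : ∀ t, b t ≠ 0) (Y : Fin s → F) (hY : ∀ k, Y k ≠ 0) :
    ∃ th : σ → F, (∀ y, th y ≠ 0) ∧ ∀ κ D, ∑ t, κ t = 0 →
      laurentEval th (T.combination d κ D) = laurentEval b κ * laurentEval Y D := by
  let S : AddSubgroup ((Fin (r + 1) → ℤ) × (Fin s → ℤ)) :=
    { carrier := {p | ∑ t, p.1 t = 0}
      add_mem' := fun {p q} hp hq => by
        simp only [Set.mem_ofPred_eq, Prod.fst_add, Pi.add_apply, Finset.sum_add_distrib] at *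
        rw [hp, hq, add_zero]
      zero_mem' := by simp
      neg_mem' := fun {p} hp => by simpa using hp }
  let f : S →+ (σ → ℤ) :=
    { toFun := fun p => T.combination d p.1.1 p.1.2
      map_zero' := T.combination_zero d
      map_add' := fun p q => T.combination_add d _ _ _ _ }
  let g : S →+ Additive Fˣ :=
    { toFun := fun p => Additive.ofMul (Units.mk0 (laurentEval b p.1.1 * laurentEval Y p.1.2)
        (mul_ne_zero (laurentEval_ne_zero hb _) (laurentEval_ne_zero hY _)))
      map_zero' := congrArg Additive.ofMul (Units.ext (by simp [laurentEval_zero]))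
      map_add' := fun p q => congrArg Additive.ofMul (Units.ext (by
        simp only [AddSubgroup.coe_add, Prod.fst_add, Prod.snd_add, laurentEval_add hb,
          laurentEval_add hY, Units.val_mk0, toMul_ofMul, Units.val_mul]
        ring)) }
  obtain ⟨th, hth, hth'⟩ := exists_laurentEval_eq f ((injective_iff_map_eq_zero f).mpr
    fun p hp => by
      obtain ⟨h1, h2⟩ := h.injective _ _ p.2 hp
      exact Subtype.ext (Prod.ext h1 h2)) g
  exact ⟨th, hth, fun κ D hκ => hth' ⟨(κ, D), hκ⟩⟩

/-- Exponent vectors which differ by combinations of the block exponents can be written with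
non-negative coefficients over a common exponent vector. -/
theorem exists_common_expo {σ : Type*} (T : Trinomial 𝕂 r σ) (S : Finset (σ →₀ ℕ)) (hS : S.Nonempty)
    (x : σ → ℤ) (κ : (σ →₀ ℕ) → Fin (r + 1) → ℤ) (hκ : ∀ e ∈ S, ∑ t, κ e t = 0)
    (he : ∀ e ∈ S, ∀ y, (e y : ℤ) = x y + ∑ t, κ e t * (T.expo t y : ℤ)) :
    ∃ (n₀ : σ → ℕ) (k : (σ →₀ ℕ) → Fin (r + 1) → ℕ) (m : Fin (r + 1) → ℤ) (n : ℕ), ∀ e ∈ S,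
      (∀ y, e y = n₀ y + ∑ t, k e t * T.expo t y) ∧ ∑ t, k e t = n ∧ ∀ t, κ e t = k e t + m t := by
  set m : Fin (r + 1) → ℤ := fun t => S.inf' hS fun e => κ e t with hm
  have hle : ∀ e ∈ S, ∀ t, m t ≤ κ e t := fun e h t => Finset.inf'_le _ h
  have h0 : ∀ y, 0 ≤ x y + ∑ t, m t * (T.expo t y : ℤ) := by
    intro y
    rcases hy : T.blk y with _ | t
    · obtain ⟨e, h⟩ := hS
      have := he e h y
      rw [T.sum_mul_expo_of_blk_none _ hy] at this ⊢
      omega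
    · obtain ⟨e, h, e1⟩ := Finset.exists_mem_eq_inf' hS fun e => κ e t
      have := he e h y
      rw [T.sum_mul_expo_of_blk _ hy] at this ⊢
      have h2 : m t = κ e t := e1
      rw [h2]
      omega
  refine ⟨fun y => (x y + ∑ t, m t * (T.expo t y : ℤ)).toNat, fun e t => (κ e t - m t).toNat, m,
    (-∑ t, m t).toNat, fun e h => ?_⟩
  have hk : ∀ t, (((κ e t - m t).toNat : ℕ) : ℤ) = κ e t - m t :=
    fun t => Int.toNat_of_nonneg (sub_nonneg.mpr (hle e h t))
  refine ⟨fun y => ?_, ?_, fun t => ?_⟩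
  · zify
    rw [Int.toNat_of_nonneg (h0 y), he e h y]
    simp only [hk, sub_mul, Finset.sum_sub_distrib]
    ring
  · have : (((∑ t, (κ e t - m t).toNat : ℕ)) : ℤ) = -∑ t, m t := by
      push_cast
      simp only [hk, Finset.sum_sub_distrib, hκ e h]
      ring
    change ∑ t, (κ e t - m t).toNat = _
    omega
  · rw [hk]
    ring

end Trinomial
end Trinomial

/-! ### Homogeneous polynomials vanishing at torus points -/

section Trinomial
namespace Trinomial

variable {𝕂 σ : Type*} [Field 𝕂] {r s : ℕ} [Fintype σ]

/-- The monomial of block `t`. -/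
noncomputable def mon (T : Trinomial 𝕂 r σ) (t : Fin (r + 1)) : MvPolynomial σ 𝕂 :=
  ∏ y, X y ^ T.expo t y

/-- The relations, which express each monomial of a block by those of the blocks `0` and `1`. -/
def relations (T : Trinomial 𝕂 r σ) : Set (MvPolynomial σ 𝕂) :=
  Set.range fun t => T.mon t - (C (T.δ t) * T.mon 0 + C (T.β t) * T.mon 1)

theorem prod_X_pow_eq_mul_prod_mon (T : Trinomial 𝕂 r σ) {e n₀ : σ → ℕ} {k : Fin (r + 1) → ℕ}
    (h : ∀ y, e y = n₀ y + ∑ t, k t * T.expo t y) :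
    (∏ y, X y ^ e y : MvPolynomial σ 𝕂) = (∏ y, X y ^ n₀ y) * ∏ t, T.mon t ^ k t := by
  simp only [mon, ← Finset.prod_pow]
  rw [Finset.prod_comm, ← Finset.prod_mul_distrib]
  refine Finset.prod_congr rfl fun y _ => ?_
  rw [h y, pow_add, ← Finset.prod_pow_eq_pow_sum]
  simp only [← pow_mul, mul_comm]

theorem eq_sum_C_mul_prod (f : MvPolynomial σ 𝕂) :
    f = ∑ e ∈ f.support, C (coeff e f) * ∏ y, X y ^ e y := by
  conv_lhs => rw [f.as_sum]
  refine Finset.sum_congr rfl fun e _ => ?_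
  rw [monomial_eq, Finsupp.prod_fintype _ _ fun y => pow_zero _]

/-- The coordinate ring of the degree zero part after inverting the variables is a localization
of this polynomial ring: the inner variable is the quotient of the monomials of the blocks `1` and
`0`, and the outer variables correspond to the rows of `d`. -/
abbrev Base (𝕂 : Type*) [Field 𝕂] (s : ℕ) : Type _ := MvPolynomial (Fin s) (Polynomial 𝕂)

/-- The inclusion of the constants. -/
noncomputable def baseConst (𝕂 : Type*) [Field 𝕂] (s : ℕ) : 𝕂 →+* Base 𝕂 s :=
  (C : Polynomial 𝕂 →+* Base 𝕂 s).comp Polynomial.C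

variable {F : Type*} [Field F]

theorem exists_nat_le_add {E τ : Type*} [Fintype τ] (S : Finset E) (κ : E → τ → ℤ) :
    ∃ N : ℕ, ∀ e ∈ S, ∀ t, 0 ≤ κ e t + N := by
  refine ⟨∑ e ∈ S, ∑ t, (κ e t).natAbs, fun e he t => ?_⟩
  have h1 : (κ e t).natAbs ≤ ∑ t, (κ e t).natAbs :=
    Finset.single_le_sum (f := fun t => (κ e t).natAbs) (fun _ _ => Nat.zero_le _)
      (Finset.mem_univ t)
  have h2 : ∑ t, (κ e t).natAbs ≤ ∑ e ∈ S, ∑ t, (κ e t).natAbs :=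
    Finset.single_le_sum (f := fun e => ∑ t, (κ e t).natAbs) (fun _ _ => Nat.zero_le _) he
  omega

theorem laurentEval_mul_laurentEval_const {τ : Type*} [Fintype τ] {θ : τ → F} (hθ : ∀ t, θ t ≠ 0)
    {x : τ → ℤ} {N : ℕ} (h : ∀ t, 0 ≤ x t + N) :
    laurentEval θ x * laurentEval θ (fun _ => (N : ℤ)) = ∏ t, θ t ^ (x t + N).toNat := by
  rw [← laurentEval_add hθ, ← laurentEval_natCast]
  congr 1
  funext t
  exact (Int.toNat_of_nonneg (h t)).symm

/-- Independence of the outer variables over the inner ones, for sums of Laurent monomials. -/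
theorem sum_fiber_eq_zero {E : Type*} (S : Finset E) (c : E → Polynomial 𝕂)
    (κ : E → Fin (r + 1) → ℤ) (D : E → Fin s → ℤ) (b : Fin (r + 1) → Polynomial 𝕂)
    (hb : ∀ t, b t ≠ 0) (ι : Base 𝕂 s →+* F) (hι : Function.Injective ι)
    (h : ∑ e ∈ S, ι (C (c e)) * (laurentEval (fun t => ι (C (b t))) (κ e) *
      laurentEval (fun k => ι (X k)) (D e)) = 0) (D₀ : Fin s → ℤ) [DecidableEq (Fin s → ℤ)] :
    ∑ e ∈ S with D e = D₀, ι (C (c e)) * laurentEval (fun t => ι (C (b t))) (κ e) = 0 := by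
  classical
  have hb' : ∀ t, ι (C (b t)) ≠ 0 := fun t =>
    (map_ne_zero_iff ι hι).mpr ((map_ne_zero_iff _ (C_injective _ _)).mpr (hb t))
  have hX' : ∀ k, ι (X k) ≠ 0 := fun k => (map_ne_zero_iff ι hι).mpr (X_ne_zero k)
  obtain ⟨N, hN⟩ := exists_nat_le_add S κ
  obtain ⟨M, hM⟩ := exists_nat_le_add S D
  by_cases hD : ∃ e ∈ S, D e = D₀
  swap
  · rw [Finset.filter_false_of_mem fun e he hDe => hD ⟨e, he, hDe⟩, Finset.sum_empty]
  set p : E → Polynomial 𝕂 := fun e => c e * ∏ t, b t ^ (κ e t + N).toNat with hp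
  set n : (Fin s → ℤ) → (Fin s →₀ ℕ) := fun x =>
    Finsupp.equivFunOnFinite.symm fun k => (x k + M).toNat with hn
  have hpe : ∀ e ∈ S, ι (C (p e)) = ι (C (c e)) * (laurentEval (fun t => ι (C (b t))) (κ e) *
      laurentEval (fun t => ι (C (b t))) fun _ => (N : ℤ)) := by
    intro e he
    rw [laurentEval_mul_laurentEval_const hb' (hN e he)]
    simp [hp, map_mul, map_prod, map_pow]
  have h0 : ∑ e ∈ S, monomial (n (D e)) (p e) = (0 : Base 𝕂 s) := by
    apply hι
    rw [map_sum, map_zero, ← zero_mul ((laurentEval (fun t => ι (C (b t))) fun _ => (N : ℤ)) *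
      laurentEval (fun k => ι (X k)) fun _ => (M : ℤ)), ← h, Finset.sum_mul]
    refine Finset.sum_congr rfl fun e he => ?_
    have : ι (monomial (n (D e)) (p e)) = ι (C (p e)) * (laurentEval (fun k => ι (X k)) (D e) *
        laurentEval (fun k => ι (X k)) fun _ => (M : ℤ)) := by
      rw [laurentEval_mul_laurentEval_const hX' (hM e he), monomial_eq,
        Finsupp.prod_fintype _ _ fun y => pow_zero _]
      simp [hn, map_mul, map_prod, map_pow]
    rw [this, hpe e he]
    ring
  obtain ⟨e₀, he₀, rfl⟩ := hD
  have h1 := congrArg (coeff (n (D e₀))) h0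
  rw [coeff_sum, coeff_zero] at h1
  simp only [coeff_monomial] at h1
  rw [← Finset.sum_filter] at h1
  have hfilter : S.filter (fun e => n (D e) = n (D e₀)) = S.filter (fun e => D e = D e₀) := by
    refine Finset.filter_congr fun e he => ⟨fun hne => ?_, fun hne => by rw [hne]⟩
    funext k
    have := DFunLike.congr_fun hne k
    simp only [hn, Finsupp.equivFunOnFinite_symm_apply_apply] at this
    have h1 := hM e he k
    have h2 := hM e₀ he₀ k
    omega
  rw [hfilter] at h1
  have h2 := congrArg (fun q => ι (C q)) h1
  simp only [map_sum, map_zero] at h2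
  have h3 : (∑ e ∈ S with D e = D e₀, ι (C (c e)) * laurentEval (fun t => ι (C (b t))) (κ e)) *
      (laurentEval (fun t => ι (C (b t))) fun _ => (N : ℤ)) = 0 := by
    rw [← h2, Finset.sum_mul]
    refine Finset.sum_congr rfl fun e he => ?_
    rw [hpe e (Finset.mem_filter.mp he).1, mul_assoc]
  exact (mul_eq_zero.mp h3).resolve_right (laurentEval_ne_zero hb' _)

variable {K : Type*} [AddCommGroup K] {w : σ → K} {d : Fin s → σ → ℤ} {T : Trinomial 𝕂 r σ}

/-- The evaluation homomorphism at a point `th`, over a field that contains the base ring. -/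
noncomputable def evalHom (ι : Base 𝕂 s →+* F) (th : σ → F) : MvPolynomial σ 𝕂 →+* F :=
  eval₂Hom (ι.comp (baseConst 𝕂 s)) th

theorem evalHom_C_mul_prod (ι : Base 𝕂 s →+* F) (th : σ → F) (a : 𝕂) (n : σ → ℕ) :
    evalHom ι th (C a * ∏ y, X y ^ n y) =
      ι (C (Polynomial.C a)) * laurentEval th fun y => (n y : ℤ) := by
  simp [evalHom, baseConst, laurentEval_natCast]

theorem weight_eq_linearCombination (w : σ → K) (e : σ →₀ ℕ) :
    Finsupp.weight w e = Fintype.linearCombination ℤ w fun y => (e y : ℤ) := by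
  rw [Finsupp.weight_apply, Fintype.linearCombination_apply, Finsupp.sum_fintype _ _ (by simp)]
  simp

/-- The exponents of a homogeneous polynomial, relative to one of them. -/
theorem IsGradedBy.exists_combination (h : T.IsGradedBy w d) {f : MvPolynomial σ 𝕂} {k : K}
    (hf : IsWeightedHomogeneous w f k) {e₀ : σ →₀ ℕ} (he₀ : e₀ ∈ f.support) :
    ∃ (κ : (σ →₀ ℕ) → Fin (r + 1) → ℤ) (D : (σ →₀ ℕ) → Fin s → ℤ), ∀ e ∈ f.support,
      ∑ t, κ e t = 0 ∧
      (fun y => (e y : ℤ)) = (fun y => (e₀ y : ℤ)) + T.combination d (κ e) (D e) := by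
  have key : ∀ e : σ →₀ ℕ, ∃ (κ : Fin (r + 1) → ℤ) (D : Fin s → ℤ), e ∈ f.support →
      ∑ t, κ t = 0 ∧
      (fun y => (e y : ℤ)) = (fun y => (e₀ y : ℤ)) + T.combination d κ D := by
    intro e
    by_cases he : e ∈ f.support
    · obtain ⟨κ, D, hκ, hx⟩ := (h.eq_zero_iff ((fun y => (e y : ℤ)) - fun y => (e₀ y : ℤ))).mp (by
        rw [map_sub, ← weight_eq_linearCombination, ← weight_eq_linearCombination,
          hf (mem_support_iff.mp he), hf (mem_support_iff.mp he₀), sub_self])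
      exact ⟨κ, D, fun _ => ⟨hκ, by rw [← hx]; abel⟩⟩
    · exact ⟨0, 0, fun h => absurd h he⟩
  choose κ D hκ using key
  exact ⟨κ, D, hκ⟩

/-- A point of the torus at which the Laurent monomials of degree zero have values prescribed by
polynomials `b t` for the blocks and by independent variables for the rows of `d`. -/
structure IsPoint (T : Trinomial 𝕂 r σ) (d : Fin s → σ → ℤ) (ι : Base 𝕂 s →+* F)
    (b : Fin (r + 1) → Polynomial 𝕂) (th : σ → F) : Prop where
  injective : Function.Injective ι
  b_ne_zero : ∀ t, b t ≠ 0
  ne_zero : ∀ y, th y ≠ 0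
  eval : ∀ κ D, ∑ t, κ t = 0 → laurentEval th (T.combination d κ D) =
    laurentEval (fun t => ι (C (b t))) κ * laurentEval (fun k => ι (X k)) D

theorem IsPoint.map_b_ne_zero {ι : Base 𝕂 s →+* F} {b : Fin (r + 1) → Polynomial 𝕂} {th : σ → F}
    (hth : T.IsPoint d ι b th) (t : Fin (r + 1)) : ι (C (b t)) ≠ 0 :=
  (map_ne_zero_iff ι hth.injective).mpr
    ((map_ne_zero_iff _ (C_injective _ _)).mpr (hth.b_ne_zero t))

/-- Membership of a homogeneous polynomial vanishing at a point in an ideal `J` follows from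
membership of those polynomials vanishing at the point whose exponents differ by non-negative
combinations of the block exponents only. -/
theorem IsGradedBy.mem_of_evalHom_eq_zero (h : T.IsGradedBy w d) {ι : Base 𝕂 s →+* F}
    {b : Fin (r + 1) → Polynomial 𝕂} {th : σ → F} (hth : T.IsPoint d ι b th)
    (J : Ideal (MvPolynomial σ 𝕂)) {f : MvPolynomial σ 𝕂} {k : K}
    (hf : IsWeightedHomogeneous w f k)
    (hJ : ∀ S ⊆ f.support, ∀ (n₀ : σ → ℕ) (k : (σ →₀ ℕ) → Fin (r + 1) → ℕ) (n : ℕ),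
      (∀ e ∈ S, (∀ y, e y = n₀ y + ∑ t, k e t * T.expo t y) ∧ ∑ t, k e t = n) →
      ∑ e ∈ S, Polynomial.C (coeff e f) * ∏ t, b t ^ k e t = 0 →
      ∑ e ∈ S, C (coeff e f) * ∏ y, X y ^ e y ∈ J)
    (h0 : evalHom ι th f = 0) : f ∈ J := by
  classical
  rcases f.support.eq_empty_or_nonempty with hS | ⟨e₀, he₀⟩
  · rw [support_eq_empty.mp hS]
    exact J.zero_mem
  obtain ⟨κ, D, hκ⟩ := h.exists_combination hf he₀
  have h1 : ∑ e ∈ f.support, ι (C (Polynomial.C (coeff e f))) *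
      (laurentEval (fun t => ι (C (b t))) (κ e) * laurentEval (fun k => ι (X k)) (D e)) = 0 := by
    apply mul_left_cancel₀ (laurentEval_ne_zero hth.ne_zero fun y => (e₀ y : ℤ))
    rw [mul_zero, ← h0, eq_sum_C_mul_prod f, map_sum, ← eq_sum_C_mul_prod f, Finset.mul_sum]
    refine Finset.sum_congr rfl fun e he => ?_
    rw [evalHom_C_mul_prod, (hκ e he).2, laurentEval_add hth.ne_zero, hth.eval _ _ (hκ e he).1]
    ring
  rw [eq_sum_C_mul_prod f, ← Finset.sum_fiberwise_of_maps_to (t := f.support.image D)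
    (fun e he => Finset.mem_image_of_mem D he)]
  refine J.sum_mem fun D₀ hD₀ => ?_
  have hfib := sum_fiber_eq_zero f.support _ κ D b hth.b_ne_zero ι hth.injective h1 D₀
  set S := f.support.filter fun e => D e = D₀ with hSdef
  have hSsub : S ⊆ f.support := Finset.filter_subset _ _
  obtain ⟨e₁, he₁, hD₁⟩ := Finset.mem_image.mp hD₀
  obtain ⟨n₀, k, m, n, hk⟩ := T.exists_common_expo S ⟨e₁, Finset.mem_filter.mpr ⟨he₁, hD₁⟩⟩
    (fun y => (e₀ y : ℤ) + ∑ k, D₀ k * d k y) κ (fun e he => (hκ e (hSsub he)).1) (by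
      intro e he y
      have := congrFun (hκ e (hSsub he)).2 y
      simp only [combination, Pi.add_apply, (Finset.mem_filter.mp he).2] at this
      rw [this]
      ring)
  refine hJ S hSsub n₀ k n (fun e he => ⟨(hk e he).1, (hk e he).2.1⟩) ?_
  apply (C_injective (Fin s) (Polynomial 𝕂))
  apply hth.injective
  apply mul_left_cancel₀ (laurentEval_ne_zero hth.map_b_ne_zero m)
  rw [map_zero, map_zero, mul_zero, ← hfib, map_sum, map_sum, Finset.mul_sum]
  refine Finset.sum_congr rfl fun e he => ?_
  have : κ e = (fun t => (k e t : ℤ)) + m := funext fun t => (hk e he).2.2 t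
  rw [this, laurentEval_add hth.map_b_ne_zero, laurentEval_natCast]
  simp only [map_mul, map_prod, map_pow]
  ring

/-- The forms `δ t * p + β t * q` on two parameters satisfy the relations. -/
theorem map_relation_eq_zero (T : Trinomial 𝕂 r σ) {B : Type*} [CommRing B]
    (φ : MvPolynomial σ 𝕂 →+* B) (p q : B)
    (h : ∀ t, φ (T.mon t) = φ (C (T.δ t)) * p + φ (C (T.β t)) * q) :
    Ideal.span T.relations ≤ RingHom.ker φ := by
  rw [Ideal.span_le]
  rintro _ ⟨t, rfl⟩
  change φ _ = 0
  rw [map_sub, map_add, map_mul, map_mul, h t, h 0, h 1, T.δ_zero, T.β_zero, T.δ_one, T.β_one]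
  simp

theorem mk_mon (T : Trinomial 𝕂 r σ) {J : Ideal (MvPolynomial σ 𝕂)}
    (hJ : Ideal.span T.relations ≤ J) (t : Fin (r + 1)) :
    Ideal.Quotient.mk J (T.mon t) = Ideal.Quotient.mk J (C (T.δ t)) * Ideal.Quotient.mk J (T.mon 0)
      + Ideal.Quotient.mk J (C (T.β t)) * Ideal.Quotient.mk J (T.mon 1) := by
  rw [← map_mul, ← map_mul, ← map_add, Ideal.Quotient.eq]
  exact hJ (Ideal.subset_span ⟨t, rfl⟩)

/-- The values of the block monomials at a generic point, normalized to `1` for block `0`. -/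
noncomputable def genericForm (T : Trinomial 𝕂 r σ) (t : Fin (r + 1)) : Polynomial 𝕂 :=
  Polynomial.C (T.δ t) + Polynomial.C (T.β t) * Polynomial.X

/-- Generic points detect the ideal of relations among homogeneous polynomials: modulo the
relations, the block monomials are binary forms in two of them, and a binary form is determined by
its dehomogenization. -/
theorem IsGradedBy.mem_span_relations (h : T.IsGradedBy w d) {ι : Base 𝕂 s →+* F} {th : σ → F}
    (hth : T.IsPoint d ι T.genericForm th) {f : MvPolynomial σ 𝕂} {k : K}
    (hf : IsWeightedHomogeneous w f k) (h0 : evalHom ι th f = 0) :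
    f ∈ Ideal.span T.relations := by
  refine h.mem_of_evalHom_eq_zero hth _ hf ?_ h0
  intro S _ n₀ k n hk hzero
  set J := Ideal.span T.relations
  have hdeg : ∀ t, (T.genericForm t).natDegree ≤ 1 := by
    intro t
    rw [genericForm, add_comm]
    exact Polynomial.natDegree_linear_le
  have hhom : ∀ e ∈ S, Polynomial.homogenize (∏ t, T.genericForm t ^ k e t) n =
      ∏ t, (C (T.δ t) * X 1 + C (T.β t) * X 0) ^ k e t := by
    intro e he
    rw [← (hk e he).2, Polynomial.homogenize_finsetProd fun t _ =>
      Polynomial.natDegree_pow_le_of_le (k e t) (hdeg t) |>.trans (by rw [mul_one])]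
    refine Finset.prod_congr rfl fun t _ => ?_
    have h1 : Polynomial.homogenize (T.genericForm t) 1 = C (T.δ t) * X 1 + C (T.β t) * X 0 := by
      rw [genericForm, Polynomial.homogenize_add, Polynomial.homogenize_C,
        Polynomial.homogenize_C_mul, Polynomial.homogenize_X one_ne_zero]
      simp
    have h2 := Polynomial.homogenize_finsetProd (s := Finset.range (k e t))
      (p := fun _ => T.genericForm t) (n := fun _ => 1) fun _ _ => hdeg t
    simpa [h1] using h2
  have hz := congrArg (fun p => Polynomial.homogenize p n) hzero
  simp only [Polynomial.homogenize_finsetSum, Polynomial.homogenize_C_mul,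
    Polynomial.homogenize_zero] at hz
  rw [Finset.sum_congr rfl fun e he => by rw [hhom e he]] at hz
  have hz' := congrArg (eval₂Hom ((Ideal.Quotient.mk J).comp C)
    ![Ideal.Quotient.mk J (T.mon 1), Ideal.Quotient.mk J (T.mon 0)]) hz
  rw [← Ideal.Quotient.eq_zero_iff_mem, map_sum,
    ← mul_zero (Ideal.Quotient.mk J (∏ y, X y ^ n₀ y)), ← map_zero (eval₂Hom
      ((Ideal.Quotient.mk J).comp C) ![Ideal.Quotient.mk J (T.mon 1),
        Ideal.Quotient.mk J (T.mon 0)]), ← hz', map_sum, Finset.mul_sum]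
  refine Finset.sum_congr rfl fun e he => ?_
  rw [T.prod_X_pow_eq_mul_prod_mon (hk e he).1]
  simp only [map_mul, map_prod, map_pow, map_add, coe_eval₂Hom, eval₂_C, eval₂_X,
    RingHom.comp_apply, Matrix.cons_val_zero, Matrix.cons_val_one]
  have hprod : ∏ t, Ideal.Quotient.mk J (T.mon t) ^ k e t =
      ∏ t, (Ideal.Quotient.mk J (C (T.δ t)) * Ideal.Quotient.mk J (T.mon 0) +
        Ideal.Quotient.mk J (C (T.β t)) * Ideal.Quotient.mk J (T.mon 1)) ^ k e t :=
    Finset.prod_congr rfl fun t _ => by rw [T.mk_mon le_rfl t]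
  rw [hprod]
  ring

/-- The values of the block monomials at a point where the monomial of block `i` vanishes, up to a
common factor. -/
def specialForm (T : Trinomial 𝕂 r σ) (i t : Fin (r + 1)) : 𝕂 := T.δ i * T.β t - T.β i * T.δ t

theorem exists_mk_mon_eq_specialForm (T : Trinomial 𝕂 r σ) {J : Ideal (MvPolynomial σ 𝕂)}
    (hJ : Ideal.span T.relations ≤ J) {i : Fin (r + 1)} (hi : T.mon i ∈ J) :
    ∃ W, ∀ t, Ideal.Quotient.mk J (T.mon t) = Ideal.Quotient.mk J (C (T.specialForm i t)) * W := by
  have hi' := T.mk_mon hJ i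
  rw [Ideal.Quotient.eq_zero_iff_mem.mpr hi] at hi'
  by_cases hi0 : i = 0
  · subst hi0
    refine ⟨Ideal.Quotient.mk J (T.mon 1), fun t => ?_⟩
    rw [T.mk_mon hJ t, Ideal.Quotient.eq_zero_iff_mem.mpr hi]
    simp [specialForm, T.δ_zero, T.β_zero]
  · have hβ : T.β i ≠ 0 := by
      have := T.minor_ne_zero i 0 hi0
      simpa [T.δ_zero, T.β_zero] using this
    have hinv : Ideal.Quotient.mk J (C (T.β i)) * Ideal.Quotient.mk J (C (T.β i)⁻¹) = 1 := by
      rw [← map_mul, ← C_mul, mul_inv_cancel₀ hβ, C_1, map_one]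
    refine ⟨-Ideal.Quotient.mk J (C (T.β i)⁻¹) * Ideal.Quotient.mk J (T.mon 0), fun t => ?_⟩
    rw [T.mk_mon hJ t]
    simp only [specialForm, map_sub, map_mul]
    linear_combination (-Ideal.Quotient.mk J (C (T.δ t)) * Ideal.Quotient.mk J (T.mon 0) -
      Ideal.Quotient.mk J (C (T.β t)) * Ideal.Quotient.mk J (T.mon 1)) * hinv -
      Ideal.Quotient.mk J (C (T.β t)) * Ideal.Quotient.mk J (C (T.β i)⁻¹) * hi'

/-- Special points detect the ideal generated by the relations and a variable of block `i`, among
homogeneous polynomials free of this variable. The value `1` for block `i` is irrelevant, since the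
block does not contribute. -/
theorem IsGradedBy.mem_span_relations_sup (h : T.IsGradedBy w d) {ι : Base 𝕂 s →+* F} {th : σ → F}
    {x : σ} {i : Fin (r + 1)} (hx : T.blk x = some i)
    (hth : T.IsPoint d ι (fun t => if t = i then 1 else Polynomial.C (T.specialForm i t)) th)
    {f : MvPolynomial σ 𝕂} {k : K} (hf : IsWeightedHomogeneous w f k)
    (hfx : ∀ e ∈ f.support, e x = 0) (h0 : evalHom ι th f = 0) :
    f ∈ Ideal.span T.relations ⊔ Ideal.span {X x} := by
  refine h.mem_of_evalHom_eq_zero hth _ hf ?_ h0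
  intro S hS n₀ k n hk hzero
  set J := Ideal.span T.relations ⊔ Ideal.span {X x} with hJdef
  have hki : ∀ e ∈ S, k e i = 0 := by
    intro e he
    have h1 := (hk e he).1 x
    rw [hfx e (hS he)] at h1
    have h2 := T.sum_mul_expo_of_blk (k e) hx
    simp only [Nat.cast_id] at h2
    rw [h2] at h1
    have := T.l_pos x
    rcases Nat.eq_zero_or_pos (k e i) with h3 | h3
    · exact h3
    · have := Nat.mul_pos h3 this
      omega
  have hmon : T.mon i ∈ J := by
    refine Ideal.mem_sup_right (Ideal.mem_span_singleton.mpr ?_)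
    refine (dvd_pow_self _ ?_).trans (Finset.dvd_prod_of_mem _ (Finset.mem_univ x))
    rw [T.expo_of_blk hx]
    exact (T.l_pos x).ne'
  obtain ⟨W, hW⟩ := T.exists_mk_mon_eq_specialForm (J := J) le_sup_left hmon
  have hzero' : ∑ e ∈ S, coeff e f * ∏ t, T.specialForm i t ^ k e t = 0 := by
    apply Polynomial.C_injective
    rw [map_zero, ← hzero, map_sum]
    refine Finset.sum_congr rfl fun e he => ?_
    rw [map_mul, map_prod]
    congr 1
    refine Finset.prod_congr rfl fun t _ => ?_
    by_cases ht : t = i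
    · rw [ht, hki e he, pow_zero, pow_zero, map_one]
    · rw [if_neg ht, map_pow]
  rw [← Ideal.Quotient.eq_zero_iff_mem, map_sum]
  have hz' := congrArg (fun a => Ideal.Quotient.mk J (C a) *
    (Ideal.Quotient.mk J (∏ y, X y ^ n₀ y) * W ^ n)) hzero'
  simp only [map_zero, zero_mul, map_sum, Finset.sum_mul] at hz'
  rw [← hz']
  refine Finset.sum_congr rfl fun e he => ?_
  rw [T.prod_X_pow_eq_mul_prod_mon (hk e he).1]
  simp only [map_mul, map_prod, map_pow, hW, mul_pow, Finset.prod_mul_distrib,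
    Finset.prod_pow_eq_pow_sum, (hk e he).2]
  ring

end Trinomial
end Trinomial

/-! ### The grading of a trinomial algebra -/

section Trinomial
namespace Trinomial

variable {𝕂 σ : Type*} [Field 𝕂] {r s : ℕ} [Fintype σ] {F : Type*} [Field F]
  {K : Type*} [AddCommGroup K] {w : σ → K} {d : Fin s → σ → ℤ} {T : Trinomial 𝕂 r σ}

theorem isWeightedHomogeneous_C_mul_prod (w : σ → K) (a : 𝕂) (n : σ → ℕ) :
    IsWeightedHomogeneous w (C a * ∏ y, X y ^ n y)
      (Fintype.linearCombination ℤ w fun y => (n y : ℤ)) := by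
  refine IsWeightedHomogeneous.C_mul ?_ a
  rw [Fintype.linearCombination_apply]
  simp only [natCast_zsmul]
  exact IsWeightedHomogeneous.prod _ _ _ fun y _ => (isWeightedHomogeneous_X 𝕂 w y).pow (n y)

theorem isWeightedHomogeneous_mon (T : Trinomial 𝕂 r σ) (w : σ → K) (t : Fin (r + 1)) :
    IsWeightedHomogeneous w (T.mon t)
      (Fintype.linearCombination ℤ w fun y => (T.expo t y : ℤ)) := by
  have := isWeightedHomogeneous_C_mul_prod (𝕂 := 𝕂) w 1 (T.expo t)
  rwa [C_1, one_mul] at this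

theorem sum_single_sub_single (t : Fin (r + 1)) :
    ∑ t', (Pi.single t 1 - Pi.single 0 1 : Fin (r + 1) → ℤ) t' = 0 := by
  simp [Finset.sum_sub_distrib]

theorem IsGradedBy.linearCombination_expo (h : T.IsGradedBy w d) (t : Fin (r + 1)) :
    Fintype.linearCombination ℤ w (fun y => (T.expo t y : ℤ)) =
      Fintype.linearCombination ℤ w fun y => (T.expo 0 y : ℤ) := by
  rw [← sub_eq_zero, ← map_sub]
  exact (h.eq_zero_iff _).mpr ⟨_, 0, sum_single_sub_single t,
    (T.combination_single_sub_single d t).symm⟩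

theorem IsGradedBy.isGrading (h : T.IsGradedBy w d) :
    IsGrading (quotientGrading w (Ideal.span T.relations)) := by
  refine isGrading_quotientGrading w _ ?_
  rintro _ ⟨t, rfl⟩
  have hm := fun t => h.linearCombination_expo t ▸ T.isWeightedHomogeneous_mon w t
  exact ⟨_, (hm t).sub (((hm 0).C_mul _).add ((hm 1).C_mul _))⟩

theorem evalHom_C {σ : Type*} (ι : Base 𝕂 s →+* F) (th : σ → F) (a : 𝕂) :
    evalHom ι th (C a) = ι (C (Polynomial.C a)) := by
  simp [evalHom, baseConst]

theorem evalHom_X {σ : Type*} (ι : Base 𝕂 s →+* F) (th : σ → F) (y : σ) :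
    evalHom ι th (X y) = th y := by
  simp [evalHom]

theorem evalHom_mon (ι : Base 𝕂 s →+* F) (th : σ → F) (t : Fin (r + 1)) :
    evalHom ι th (T.mon t) = ∏ y, th y ^ T.expo t y := by
  simp [mon, map_prod, evalHom_X]

/-- The values of the block monomials at a point of the torus are proportional to the `b t`. -/
theorem IsPoint.evalHom_mon_eq {ι : Base 𝕂 s →+* F} {b : Fin (r + 1) → Polynomial 𝕂} {th : σ → F}
    (hth : T.IsPoint d ι b th) (t : Fin (r + 1)) :
    evalHom ι th (T.mon t) = evalHom ι th (T.mon 0) / ι (C (b 0)) * ι (C (b t)) := by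
  classical
  have h1 := hth.eval _ 0 (sum_single_sub_single t)
  have hs : ∀ t, laurentEval (fun t => ι (C (b t))) (Pi.single t 1) = ι (C (b t)) := by
    intro t
    rw [laurentEval, Finset.prod_eq_single t] <;> simp +contextual
  rw [T.combination_single_sub_single, laurentEval_sub hth.ne_zero, laurentEval_zero, mul_one,
    laurentEval_sub hth.map_b_ne_zero, hs, hs, laurentEval_natCast, laurentEval_natCast,
    ← evalHom_mon ι, ← evalHom_mon ι] at h1
  have h2 : evalHom ι th (T.mon 0) ≠ 0 := by
    rw [evalHom_mon]
    exact Finset.prod_ne_zero_iff.mpr fun y _ => pow_ne_zero _ (hth.ne_zero y)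
  have h3 := hth.map_b_ne_zero 0
  field_simp at h1 ⊢
  linear_combination h1

theorem IsGradedBy.exists_isPoint [IsAlgClosed F] (h : T.IsGradedBy w d) {ι : Base 𝕂 s →+* F}
    (hι : Function.Injective ι) {b : Fin (r + 1) → Polynomial 𝕂} (hb : ∀ t, b t ≠ 0) :
    ∃ th, T.IsPoint d ι b th := by
  obtain ⟨th, hth, he⟩ := h.exists_point (fun t => ι (C (b t)))
    (fun t => (map_ne_zero_iff ι hι).mpr ((map_ne_zero_iff _ (C_injective _ _)).mpr (hb t)))
    (fun k => ι (X k)) (fun k => (map_ne_zero_iff ι hι).mpr (X_ne_zero k))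
  exact ⟨th, hι, hb, hth, he⟩

theorem genericForm_zero {σ : Type*} (T : Trinomial 𝕂 r σ) : T.genericForm 0 = 1 := by
  simp [genericForm, T.δ_zero, T.β_zero]

theorem genericForm_one {σ : Type*} (T : Trinomial 𝕂 r σ) : T.genericForm 1 = Polynomial.X := by
  simp [genericForm, T.δ_one, T.β_one]

theorem β_ne_zero {σ : Type*} (T : Trinomial 𝕂 r σ) {t : Fin (r + 1)} (ht : t ≠ 0) : T.β t ≠ 0 := by
  have := T.minor_ne_zero 0 t ht.symm
  simpa [T.δ_zero, T.β_zero] using this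

theorem genericForm_ne_zero {σ : Type*} (T : Trinomial 𝕂 r σ) (t : Fin (r + 1)) :
    T.genericForm t ≠ 0 := by
  by_cases ht : t = 0
  · rw [ht, genericForm_zero]
    exact one_ne_zero
  · intro h
    have := congrArg (fun p => Polynomial.coeff p 1) h
    simp [genericForm, T.β_ne_zero ht] at this

theorem prime_genericForm {σ : Type*} (T : Trinomial 𝕂 r σ) {t : Fin (r + 1)} (ht : t ≠ 0) :
    Prime (T.genericForm t) := by
  apply Polynomial.prime_of_degree_eq_one
  rw [genericForm, add_comm]
  exact Polynomial.degree_linear (T.β_ne_zero ht)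

theorem IsPoint.span_relations_le_ker {ι : Base 𝕂 s →+* F} {th : σ → F}
    (hth : T.IsPoint d ι T.genericForm th) :
    Ideal.span T.relations ≤ RingHom.ker (evalHom ι th) := by
  refine T.map_relation_eq_zero _ (evalHom ι th (T.mon 0))
    (evalHom ι th (T.mon 0) * ι (C Polynomial.X)) fun t => ?_
  rw [hth.evalHom_mon_eq t, genericForm_zero, evalHom_C, evalHom_C]
  simp only [genericForm, map_add, map_mul, map_one]
  ring

theorem evalHom_update_of_forall [DecidableEq σ] (ι : Base 𝕂 s →+* F) (th : σ → F) {x : σ}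
    {f : MvPolynomial σ 𝕂} (hf : ∀ e ∈ f.support, e x = 0) :
    evalHom ι (Function.update th x 0) f = evalHom ι th f := by
  rw [eq_sum_C_mul_prod f, map_sum, map_sum]
  refine Finset.sum_congr rfl fun e he => ?_
  rw [evalHom_C_mul_prod, evalHom_C_mul_prod, laurentEval_natCast, laurentEval_natCast]
  congr 1
  refine Finset.prod_congr rfl fun y _ => ?_
  by_cases hy : y = x
  · rw [hy, hf e he, pow_zero, pow_zero]
  · rw [Function.update_of_ne hy]

theorem evalHom_update_mon [DecidableEq σ] (ι : Base 𝕂 s →+* F) (th : σ → F) {x : σ}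
    {t : Fin (r + 1)} (hx : T.blk x ≠ some t) :
    evalHom ι (Function.update th x 0) (T.mon t) = evalHom ι th (T.mon t) := by
  rw [evalHom_mon, evalHom_mon]
  refine Finset.prod_congr rfl fun y _ => ?_
  by_cases hy : y = x
  · rw [hy, expo, if_neg hx, pow_zero, pow_zero]
  · rw [Function.update_of_ne hy]

/-- For every variable there is a homomorphism to a field that detects divisibility of homogeneous
elements by this variable. -/
theorem IsGradedBy.exists_detecting_hom [IsAlgClosed F] (h : T.IsGradedBy w d)
    {ι : Base 𝕂 s →+* F} (hι : Function.Injective ι) (x : σ) :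
    ∃ φ : MvPolynomial σ 𝕂 →+* F, Ideal.span T.relations ≤ RingHom.ker φ ∧ φ (X x) = 0 ∧
      (∀ y, y ≠ x → φ (X y) ≠ 0) ∧ ∀ k f, IsWeightedHomogeneous w f k → φ f = 0 →
        f ∈ Ideal.span T.relations ⊔ Ideal.span {X x} := by
  classical
  -- It suffices to treat polynomials free of the variable.
  have reduce : ∀ th : σ → F,
      (∀ k f, IsWeightedHomogeneous w f k → (∀ e ∈ f.support, e x = 0) → evalHom ι th f = 0 →
        f ∈ Ideal.span T.relations ⊔ Ideal.span {X x}) →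
      ∀ k f, IsWeightedHomogeneous w f k → evalHom ι (Function.update th x 0) f = 0 →
        f ∈ Ideal.span T.relations ⊔ Ideal.span {X x} := by
    intro th H k f hf h0
    have hsplit := divMonomial_add_modMonomial_single f x
    set g := f.modMonomial (Finsupp.single x 1) with hg
    have hcoeff : ∀ e, coeff e g ≠ 0 → e x = 0 ∧ coeff e g = coeff e f := by
      intro e he
      by_cases hle : Finsupp.single x 1 ≤ e
      · exact absurd (coeff_modMonomial_of_le f hle) he
      · refine ⟨?_, coeff_modMonomial_of_not_le f hle⟩
        rw [Finsupp.single_le_iff] at hle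
        omega
    have hgx : ∀ e ∈ g.support, e x = 0 := fun e he => (hcoeff e (mem_support_iff.mp he)).1
    have hgmem : g ∈ Ideal.span T.relations ⊔ Ideal.span {X x} := by
      refine H k g (fun e he => hf ?_) hgx ?_
      · rw [← (hcoeff e he).2]
        exact he
      · rw [← evalHom_update_of_forall ι th hgx]
        have := congrArg (evalHom ι (Function.update th x 0)) hsplit
        rw [map_add, map_mul, evalHom_X, Function.update_self, zero_mul, zero_add, h0] at this
        exact this
    rw [← hsplit]
    exact add_mem (Ideal.mem_sup_right (Ideal.mul_mem_right _ _
      (Ideal.mem_span_singleton_self _))) hgmem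
  have hne : ∀ th : σ → F, (∀ y, th y ≠ 0) → ∀ y, y ≠ x →
      evalHom ι (Function.update th x 0) (X y) ≠ 0 := by
    intro th hth y hy
    rw [evalHom_X, Function.update_of_ne hy]
    exact hth y
  rcases hx : T.blk x with _ | i
  · obtain ⟨th, hth⟩ := h.exists_isPoint hι T.genericForm_ne_zero
    refine ⟨evalHom ι (Function.update th x 0), ?_, ?_, hne th hth.ne_zero, reduce th ?_⟩
    · refine T.map_relation_eq_zero _ (evalHom ι th (T.mon 0))
        (evalHom ι th (T.mon 0) * ι (C Polynomial.X)) fun t => ?_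
      rw [evalHom_update_mon ι th (by rw [hx]; simp), hth.evalHom_mon_eq t, genericForm_zero,
        evalHom_C, evalHom_C]
      simp only [genericForm, map_add, map_mul, map_one]
      ring
    · rw [evalHom_X, Function.update_self]
    · exact fun k f hf _ h0 => Ideal.mem_sup_left (h.mem_span_relations hth hf h0)
  · obtain ⟨th, hth⟩ := h.exists_isPoint hι
      (b := fun t => if t = i then 1 else Polynomial.C (T.specialForm i t)) (by
        intro t
        split_ifs with ht
        · exact one_ne_zero
        · exact (map_ne_zero_iff _ Polynomial.C_injective).mpr (T.minor_ne_zero i t (Ne.symm ht)))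
    refine ⟨evalHom ι (Function.update th x 0), ?_, ?_, hne th hth.ne_zero, reduce th ?_⟩
    · set W := evalHom ι th (T.mon 0) / ι (C (if (0 : Fin (r + 1)) = i then 1 else
        Polynomial.C (T.specialForm i 0))) with hW
      refine T.map_relation_eq_zero _ (-ι (C (Polynomial.C (T.β i))) * W)
        (ι (C (Polynomial.C (T.δ i))) * W) fun t => ?_
      rw [evalHom_C, evalHom_C]
      by_cases ht : t = i
      · subst ht
        rw [evalHom_mon, Finset.prod_eq_zero (Finset.mem_univ x)]
        · ring
        · rw [Function.update_self, T.expo_of_blk hx, zero_pow (T.l_pos x).ne']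
      · rw [evalHom_update_mon ι th (by rw [hx]; simpa using Ne.symm ht), hth.evalHom_mon_eq t,
          if_neg ht, ← hW, specialForm]
        simp only [map_sub, map_mul]
        ring
    · rw [evalHom_X, Function.update_self]
    · exact fun k f hf hfx h0 => h.mem_span_relations_sup hx hth hf hfx h0

/-- The embedding of the base ring into an algebraic closure of its field of fractions. -/
noncomputable def baseEmbedding (𝕂 : Type*) [Field 𝕂] (s : ℕ) :
    Base 𝕂 s →+* AlgebraicClosure (FractionRing (Base 𝕂 s)) :=
  (algebraMap (FractionRing (Base 𝕂 s)) _).comp (algebraMap (Base 𝕂 s) _)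

theorem baseEmbedding_injective (𝕂 : Type*) [Field 𝕂] (s : ℕ) :
    Function.Injective (baseEmbedding 𝕂 s) :=
  (algebraMap (FractionRing (Base 𝕂 s)) _).injective.comp (IsFractionRing.injective _ _)

/-- The class of a variable in the trinomial algebra. -/
noncomputable def var (T : Trinomial 𝕂 r σ) (x : σ) : MvPolynomial σ 𝕂 ⧸ Ideal.span T.relations :=
  Ideal.Quotient.mk _ (X x)

theorem var_mem_quotientGrading (T : Trinomial 𝕂 r σ) (w : σ → K) (x : σ) :
    T.var x ∈ quotientGrading w (Ideal.span T.relations) (w x) :=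
  ⟨X x, isWeightedHomogeneous_X 𝕂 w x, rfl⟩

theorem IsGradedBy.exists_quotient_hom [IsAlgClosed F] (h : T.IsGradedBy w d)
    {ι : Base 𝕂 s →+* F} (hι : Function.Injective ι) (x : σ) :
    ∃ φ : MvPolynomial σ 𝕂 ⧸ Ideal.span T.relations →+* F, φ (T.var x) = 0 ∧
      (∀ y, y ≠ x → φ (T.var y) ≠ 0) ∧
      ∀ f, SetLike.IsHomogeneousElem (quotientGrading w (Ideal.span T.relations)) f → φ f = 0 →
        T.var x ∣ f := by
  obtain ⟨φ, hker, hx, hy, hdvd⟩ := h.exists_detecting_hom hι x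
  refine ⟨Ideal.Quotient.lift _ φ hker, hx, hy, ?_⟩
  rintro _ ⟨k, f, hf, rfl⟩ h0
  obtain ⟨a, ha, b, hb, e⟩ := Submodule.mem_sup.mp (hdvd k f hf h0)
  obtain ⟨c, rfl⟩ := Ideal.mem_span_singleton.mp hb
  refine ⟨Ideal.Quotient.mk _ c, ?_⟩
  change Ideal.Quotient.mk _ f = Ideal.Quotient.mk _ (X x) * _
  rw [← e, map_add, Ideal.Quotient.eq_zero_iff_mem.mpr ha, zero_add, map_mul]

theorem IsGradedBy.isGradedPrime_var (h : T.IsGradedBy w d) (x : σ) :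
    IsGradedPrime (quotientGrading w (Ideal.span T.relations)) (T.var x) := by
  have hι := baseEmbedding_injective 𝕂 s
  obtain ⟨φ, hx, hy, hdvd⟩ := h.exists_quotient_hom hι x
  obtain ⟨th, hth⟩ := h.exists_isPoint hι T.genericForm_ne_zero
  refine ⟨⟨_, T.var_mem_quotientGrading w x⟩, fun h0 => ?_, fun hu => ?_, fun f g hf hg hd => ?_⟩
  · apply hth.ne_zero x
    rw [← evalHom_X (baseEmbedding 𝕂 s) th x]
    exact hth.span_relations_le_ker (Ideal.Quotient.eq_zero_iff_mem.mp h0)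
  · simpa [hx] using hu.map φ
  · obtain ⟨k, e⟩ := hd
    have := congrArg φ e
    rw [map_mul, map_mul, hx, zero_mul] at this
    exact (mul_eq_zero.mp this).imp (hdvd f hf) (hdvd g hg)

theorem IsGradedBy.not_dvd (h : T.IsGradedBy w d) {x y : σ} (hxy : x ≠ y) :
    ¬ T.var x ∣ T.var y := by
  have hι := baseEmbedding_injective 𝕂 s
  obtain ⟨φ, hx, hy, -⟩ := h.exists_quotient_hom hι x
  rintro ⟨k, e⟩
  exact hy y hxy.symm (by rw [e, map_mul, hx, zero_mul])

/-- For all large `n`, the element `c` of the base ring is the value at `th` of a homogeneous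
polynomial, divided by the `n`-th power of the product of all variables, of the same degree. -/
def HasLift (w : σ → K) (ι : Base 𝕂 s →+* F) (th : σ → F) (c : Base 𝕂 s) : Prop :=
  ∃ N : ℕ, ∀ n ≥ N, ∃ g : MvPolynomial σ 𝕂,
    IsWeightedHomogeneous w g (Fintype.linearCombination ℤ w fun _ => (n : ℤ)) ∧
    evalHom ι th g = laurentEval th (fun _ => (n : ℤ)) * ι c

theorem hasLift_of_laurentEval_eq {ι : Base 𝕂 s →+* F} {b : Fin (r + 1) → Polynomial 𝕂}
    {th : σ → F} (hth : T.IsPoint d ι b th) {c : Base 𝕂 s} (z : σ → ℤ)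
    (hz : Fintype.linearCombination ℤ w z = 0) (e : laurentEval th z = ι c) :
    HasLift w ι th c := by
  obtain ⟨N, hN⟩ := exists_nat_le_add {()} fun _ => z
  refine ⟨N, fun n hn => ⟨C 1 * ∏ y, X y ^ (z y + n).toNat, ?_, ?_⟩⟩
  all_goals
    have hpos : ∀ y, 0 ≤ z y + n := fun y => by
      have := hN () (Finset.mem_singleton_self _) y
      omega
    have hfun : (fun y => (((z y + n).toNat : ℕ) : ℤ)) = z + fun _ => (n : ℤ) :=
      funext fun y => Int.toNat_of_nonneg (hpos y)
  · have := isWeightedHomogeneous_C_mul_prod (𝕂 := 𝕂) w 1 fun y => (z y + n).toNat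
    rwa [hfun, map_add, hz, zero_add] at this
  · rw [evalHom_C_mul_prod, hfun, laurentEval_add hth.ne_zero, e]
    simp only [map_one, one_mul]
    ring

/-- Every element of the base ring is, up to a Laurent monomial, the value of a homogeneous
polynomial at the generic point. -/
theorem IsGradedBy.hasLift (h : T.IsGradedBy w d) {ι : Base 𝕂 s →+* F} {th : σ → F}
    (hth : T.IsPoint d ι T.genericForm th) (c : Base 𝕂 s) :
    HasLift w ι th c := by
  classical
  have hadd : ∀ c c' : Base 𝕂 s,
      HasLift w ι th c → HasLift w ι th c' → HasLift w ι th (c + c') := by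
    rintro c c' ⟨N, hN⟩ ⟨N', hN'⟩
    refine ⟨max N N', fun n hn => ?_⟩
    obtain ⟨g, hg, e⟩ := hN n (le_trans (le_max_left _ _) hn)
    obtain ⟨g', hg', e'⟩ := hN' n (le_trans (le_max_right _ _) hn)
    exact ⟨g + g', hg.add hg', by rw [map_add, e, e', map_add, mul_add]⟩
  have hmul : ∀ c c' : Base 𝕂 s,
      HasLift w ι th c → HasLift w ι th c' → HasLift w ι th (c * c') := by
    rintro c c' ⟨N, hN⟩ ⟨N', hN'⟩
    refine ⟨N + N', fun n hn => ?_⟩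
    obtain ⟨g, hg, e⟩ := hN N le_rfl
    obtain ⟨g', hg', e'⟩ := hN' (n - N) (by omega)
    have hfun : (fun _ : σ => (n : ℤ)) = (fun _ => (N : ℤ)) + fun _ => ((n - N : ℕ) : ℤ) := by
      funext y
      simp only [Pi.add_apply]
      omega
    refine ⟨g * g', ?_, ?_⟩
    · rw [hfun, map_add]
      exact hg.mul hg'
    · rw [map_mul, e, e', hfun, laurentEval_add hth.ne_zero, map_mul]
      ring
  have hconst : ∀ a : 𝕂, HasLift w ι th (C (Polynomial.C a)) :=
    fun a => ⟨0, fun n _ => ⟨_, isWeightedHomogeneous_C_mul_prod w a fun _ => n, by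
      rw [evalHom_C_mul_prod, mul_comm]⟩⟩
  have hX : HasLift w ι th (C Polynomial.X) := by
    refine hasLift_of_laurentEval_eq hth (T.combination d (Pi.single 1 1 - Pi.single 0 1) 0)
      ((h.eq_zero_iff _).mpr ⟨_, _, sum_single_sub_single 1, rfl⟩) ?_
    rw [hth.eval _ _ (sum_single_sub_single 1), laurentEval_zero, mul_one,
      laurentEval_sub hth.map_b_ne_zero]
    simp [laurentEval, Pi.single_apply, apply_ite, genericForm_zero, genericForm_one]
  induction c using MvPolynomial.induction_on with
  | C p =>
    induction p using Polynomial.induction_on' with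
    | add p q hp hq =>
      rw [C_add]
      exact hadd _ _ hp hq
    | monomial n a =>
      induction n with
      | zero => exact hconst a
      | succ n ih =>
        rw [← Polynomial.monomial_mul_X, C_mul]
        exact hmul _ _ ih hX
  | add p q hp hq => exact hadd p q hp hq
  | mul_X p k hp =>
    refine hmul p _ hp (hasLift_of_laurentEval_eq hth (T.combination d 0 (Pi.single k 1))
      ((h.eq_zero_iff _).mpr ⟨_, _, by simp, rfl⟩) ?_)
    rw [hth.eval _ _ (by simp), laurentEval_zero, one_mul]
    simp [laurentEval, Pi.single_apply, apply_ite]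

/-- The primes of the base ring that become units when the variables are inverted. -/
noncomputable def basePrimes (T : Trinomial 𝕂 r σ) (s : ℕ) : Set (Base 𝕂 s) :=
  (fun t => C (T.genericForm t)) '' {t | t ≠ 0} ∪ Set.range X

theorem prod_C_genericForm_pow_mem_closure {σ : Type*} (T : Trinomial 𝕂 r σ) (k : Fin (r + 1) → ℕ) :
    ∏ t, (C (T.genericForm t) : Base 𝕂 s) ^ k t ∈ Submonoid.closure (T.basePrimes s) := by
  refine prod_mem fun t _ => pow_mem ?_ _
  by_cases ht : t = 0
  · rw [ht, genericForm_zero, C_1]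
    exact one_mem _
  · exact Submonoid.subset_closure (Or.inl ⟨t, ht, rfl⟩)

theorem prod_X_pow_mem_closure {σ : Type*} (T : Trinomial 𝕂 r σ) (k : Fin s → ℕ) :
    ∏ t, (X t : Base 𝕂 s) ^ k t ∈ Submonoid.closure (T.basePrimes s) :=
  prod_mem fun t _ => pow_mem
    (Submonoid.subset_closure (Set.mem_union_right _ (Set.mem_range_self t))) _

theorem laurentEval_mul_prod_pow {τ : Type*} [Fintype τ] {θ : τ → F} (hθ : ∀ t, θ t ≠ 0)
    (x : τ → ℤ) : laurentEval θ x * ∏ t, θ t ^ (-x t).toNat = ∏ t, θ t ^ (x t).toNat := by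
  rw [← laurentEval_natCast, ← laurentEval_natCast, ← laurentEval_add hθ]
  congr 1
  funext t
  simp only [Pi.add_apply]
  omega

theorem exists_C_of_isUnit_base (ε : (Base 𝕂 s)ˣ) :
    ∃ a : 𝕂, a ≠ 0 ∧ (ε : Base 𝕂 s) = C (Polynomial.C a) := by
  obtain ⟨p, hp, e⟩ := isUnit_iff_eq_C_of_isReduced.mp ε.isUnit
  obtain ⟨a, ha, rfl⟩ := Polynomial.isUnit_iff.mp hp
  exact ⟨a, ha.ne_zero, e⟩

theorem IsGradedBy.isGenericPoint (h : T.IsGradedBy w d) {ι : Base 𝕂 s →+* F} {th : σ → F}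
    (hth : T.IsPoint d ι T.genericForm th) :
    IsGenericPoint (quotientGrading w (Ideal.span T.relations)) w T.var
      (Ideal.Quotient.lift _ (evalHom ι th) hth.span_relations_le_ker) ι (T.basePrimes s) := by
  classical
  have hv : (Ideal.Quotient.lift _ (evalHom ι th) hth.span_relations_le_ker) ∘ T.var = th :=
    funext fun y => evalHom_X ι th y
  have hX : ∀ k, ι (X k) ≠ 0 := fun k => (map_ne_zero_iff ι hth.injective).mpr (X_ne_zero k)
  refine ⟨h.isGrading, hth.injective, T.var_mem_quotientGrading w, fun y => ?_, ?_, ?_, ?_, ?_, ?_,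
    ?_, ?_, h.isGradedPrime_var, fun y z hyz => h.not_dvd hyz⟩
  · exact (congrFun hv y).trans_ne (hth.ne_zero y)
  · rintro k _ ⟨f, hf, rfl⟩ h0
    exact Ideal.Quotient.eq_zero_iff_mem.mpr (h.mem_span_relations hth hf h0)
  · rintro k _ ⟨f, hf, rfl⟩ hf0
    rw [hv]
    have hne : f ≠ 0 := by
      rintro rfl
      exact hf0 (map_zero _)
    obtain ⟨e₀, he₀⟩ := (support_nonempty).mpr hne
    obtain ⟨κ, D, hκ⟩ := h.exists_combination hf he₀
    obtain ⟨N, hN⟩ := exists_nat_le_add f.support κ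
    obtain ⟨M, hM⟩ := exists_nat_le_add f.support D
    -- The denominators `N` on the blocks other than `0` and `M` on the rows of `d` are moved into
    -- the exponent vector; block `0` only serves to have total degree zero.
    set κ' : Fin (r + 1) → ℤ := (fun _ => (N : ℤ)) - Pi.single 0 (((r + 1 : ℕ) : ℤ) * N) with hκ'
    have hκ'0 : ∑ t, κ' t = 0 := by
      simp [hκ', Finset.sum_sub_distrib]
    have hb0 : laurentEval (fun t => ι (C (T.genericForm t)))
        (Pi.single 0 (((r + 1 : ℕ) : ℤ) * N)) = 1 := by
      rw [laurentEval, Finset.prod_eq_one]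
      intro t _
      by_cases ht : t = 0
      · rw [ht, genericForm_zero, C_1, map_one, one_zpow]
      · rw [Pi.single_eq_of_ne ht, zpow_zero]
    have hev := hth.eval κ' (fun _ => (M : ℤ)) hκ'0
    rw [hκ', laurentEval_sub hth.map_b_ne_zero, hb0, div_one, ← hκ'] at hev
    refine ⟨(fun y => (e₀ y : ℤ)) - T.combination d κ' fun _ => (M : ℤ),
      ∑ e ∈ f.support, C (Polynomial.C (coeff e f)) *
        ((∏ t, C (T.genericForm t) ^ (κ e t + N).toNat) * ∏ k, X k ^ (D e k + M).toNat), ?_, ?_⟩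
    · rw [map_sub, (h.eq_zero_iff _).mpr ⟨_, _, hκ'0, rfl⟩, sub_zero,
        ← weight_eq_linearCombination, hf (mem_support_iff.mp he₀)]
    · change evalHom ι th f = _
      rw [laurentEval_sub hth.ne_zero, hev]
      have hB := laurentEval_ne_zero hth.map_b_ne_zero fun _ => (N : ℤ)
      have hZ := laurentEval_ne_zero hX fun _ => (M : ℤ)
      rw [div_mul_eq_mul_div, eq_div_iff (mul_ne_zero hB hZ)]
      conv_lhs => rw [eq_sum_C_mul_prod f]
      rw [map_sum, map_sum, Finset.sum_mul, Finset.mul_sum]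
      refine Finset.sum_congr rfl fun e he => ?_
      simp only [map_mul ι, map_prod ι, map_pow ι]
      rw [evalHom_C_mul_prod, (hκ e he).2, laurentEval_add hth.ne_zero, hth.eval _ _ (hκ e he).1,
        ← laurentEval_mul_laurentEval_const hth.map_b_ne_zero (hN e he),
        ← laurentEval_mul_laurentEval_const hX (hM e he)]
      ring
  · intro c
    obtain ⟨N, hN⟩ := h.hasLift hth c
    obtain ⟨g, hg, e⟩ := hN N le_rfl
    rw [hv]
    exact ⟨_, _, ⟨g, hg, rfl⟩, e⟩
  · rintro _ (⟨t, ht, rfl⟩ | ⟨k, rfl⟩)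
    · exact (MvPolynomial.prime_C_iff _).mpr (T.prime_genericForm ht)
    · exact X_prime
  · rw [hv]
    rintro _ (⟨t, ht, rfl⟩ | ⟨k, rfl⟩)
    · refine ⟨T.combination d (Pi.single t 1 - Pi.single 0 1) 0,
        (h.eq_zero_iff _).mpr ⟨_, _, sum_single_sub_single t, rfl⟩, ?_⟩
      rw [hth.eval _ _ (sum_single_sub_single t), laurentEval_zero, mul_one,
        laurentEval_sub hth.map_b_ne_zero]
      simp [laurentEval, Pi.single_apply, apply_ite, genericForm_zero]
    · refine ⟨T.combination d 0 (Pi.single k 1), (h.eq_zero_iff _).mpr ⟨_, _, by simp, rfl⟩, ?_⟩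
      rw [hth.eval _ _ (by simp), laurentEval_zero, one_mul]
      simp [laurentEval, Pi.single_apply, apply_ite]
  · intro x hx
    rw [hv]
    obtain ⟨κ, D, hκ, rfl⟩ := (h.eq_zero_iff x).mp hx
    refine ⟨_, mul_mem (T.prod_C_genericForm_pow_mem_closure fun t => (-κ t).toNat)
        (T.prod_X_pow_mem_closure fun k => (-D k).toNat), _,
      mul_mem (T.prod_C_genericForm_pow_mem_closure fun t => (κ t).toNat)
        (T.prod_X_pow_mem_closure fun k => (D k).toNat), ?_⟩
    simp only [map_mul ι, map_prod ι, map_pow ι]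
    rw [hth.eval _ _ hκ, ← laurentEval_mul_prod_pow hth.map_b_ne_zero κ,
      ← laurentEval_mul_prod_pow hX D]
    ring
  · intro ε
    obtain ⟨a, ha, e⟩ := exists_C_of_isUnit_base ε
    refine ⟨Ideal.Quotient.mk _ (C a), ⟨C a, isWeightedHomogeneous_C w a, rfl⟩,
      ((isUnit_iff_ne_zero.mpr ha).map C).map _, ?_⟩
    rw [e]
    exact evalHom_C ι th a

theorem IsGradedBy.isFactorialGrading (h : T.IsGradedBy w d) :
    IsFactorialGrading (quotientGrading w (Ideal.span T.relations)) := by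
  obtain ⟨th, hth⟩ := h.exists_isPoint (baseEmbedding_injective 𝕂 s) T.genericForm_ne_zero
  exact (h.isGenericPoint hth).isFactorialGrading

theorem IsGradedBy.onlyConstantHomogeneousUnits (h : T.IsGradedBy w d) :
    OnlyConstantHomogeneousUnits (quotientGrading w (Ideal.span T.relations)) := by
  obtain ⟨th, hth⟩ := h.exists_isPoint (baseEmbedding_injective 𝕂 s) T.genericForm_ne_zero
  intro f hf hu
  have hp := h.isGenericPoint hth
  obtain ⟨hf0, ε, e⟩ := hp.exists_unit_of_isUnit hf hu
  obtain ⟨a, ha, ea⟩ := exists_C_of_isUnit_base ε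
  refine ⟨Units.mk0 a ha, hp.eq_of_map_eq hf0 ⟨C a, isWeightedHomogeneous_C w a, rfl⟩ ?_⟩
  rw [e, ea]
  exact (evalHom_C (baseEmbedding 𝕂 s) th a).symm

/-- The properties of the grading, for a possibly different description `I` of the ideal of
relations. -/
theorem IsGradedBy.quotientGrading_properties (h : T.IsGradedBy w d) {I : Ideal (MvPolynomial σ 𝕂)}
    (hI : Ideal.span T.relations = I) :
    IsGrading (quotientGrading w I) ∧ IsFactorialGrading (quotientGrading w I) ∧
      OnlyConstantHomogeneousUnits (quotientGrading w I) ∧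
      (∀ x, IsGradedPrime (quotientGrading w I) (Ideal.Quotient.mk I (X x))) ∧
      ∀ x y, x ≠ y → ¬ Ideal.Quotient.mk I (X x) ∣ Ideal.Quotient.mk I (X y) := by
  subst hI
  exact ⟨h.isGrading, h.isFactorialGrading, h.onlyConstantHomogeneousUnits, h.isGradedPrime_var,
    fun x y hxy => h.not_dvd hxy⟩

end Trinomial
end Trinomial

/-! ### Gradings defined by integral matrices -/

section GradingGroup

variable {σ ρ : Type} [Fintype σ] [Fintype ρ]

theorem linearCombination_deg (P : Matrix ρ σ ℤ) (x : σ → ℤ) :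
    Fintype.linearCombination ℤ (deg P) x = Submodule.Quotient.mk x := by
  classical
  have hx : x = ∑ y, x y • Pi.single y (1 : ℤ) := by
    funext z
    simp [Finset.sum_apply, Pi.single_apply]
  conv_rhs => rw [hx]
  rw [Fintype.linearCombination_apply, ← Submodule.mkQ_apply, map_sum]
  refine Finset.sum_congr rfl fun y _ => ?_
  rw [map_smul, Submodule.mkQ_apply, deg]

theorem linearCombination_deg_eq_zero_iff (P : Matrix ρ σ ℤ) (x : σ → ℤ) :
    Fintype.linearCombination ℤ (deg P) x = 0 ↔ ∃ v : ρ → ℤ, ∀ y, x y = ∑ i, v i * P i y := by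
  rw [linearCombination_deg, Submodule.Quotient.mk_eq_zero, LinearMap.mem_range]
  refine exists_congr fun v => ?_
  rw [funext_iff]
  refine forall_congr' fun y => ?_
  simp only [Matrix.mulVecLin_apply, Matrix.mulVec, dotProduct, Matrix.transpose_apply]
  rw [eq_comm]
  simp only [mul_comm]

/-- A column with coprime entries `P i x` yields an integral combination of the rows whose entry at
`x` is `1`, and hence an expression of the degree of `x` by the other degrees. -/
theorem isAlmostFree_deg (P : Matrix ρ σ ℤ) (hP : ∀ x, Finset.univ.gcd (P.col x) = 1) :
    IsAlmostFree (deg P) := by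
  classical
  intro x
  obtain ⟨v, hv⟩ := Finset.gcd_eq_sum_mul Finset.univ (P.col x)
  rw [hP x] at hv
  have h0 := (linearCombination_deg_eq_zero_iff P fun y => ∑ i, v i * P i y).mpr
    ⟨v, fun _ => rfl⟩
  have hxx : ∑ i, v i * P i x = 1 := by
    rw [hv]
    exact Finset.sum_congr rfl fun i _ => mul_comm _ _
  rw [Fintype.linearCombination_apply, ← Finset.add_sum_erase _ _ (Finset.mem_univ x), hxx,
    one_smul] at h0
  have hmem : ∀ y, deg P y ∈ AddSubgroup.closure (deg P '' {y | y ≠ x}) := by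
    intro y
    by_cases hy : y = x
    · rw [hy, eq_neg_of_add_eq_zero_left h0]
      exact neg_mem (sum_mem fun z hz => zsmul_mem (AddSubgroup.subset_closure
        (Set.mem_image_of_mem _ (Finset.ne_of_mem_erase hz))) _)
    · exact AddSubgroup.subset_closure ⟨y, hy, rfl⟩
  rw [eq_top_iff]
  rintro k -
  obtain ⟨z, rfl⟩ := Submodule.Quotient.mk_surjective _ k
  rw [← linearCombination_deg, Fintype.linearCombination_apply]
  exact sum_mem fun y _ => zsmul_mem (hmem y) _

/-- The rows of a matrix whose columns generate the rational vector space are independent. -/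
theorem eq_zero_of_sum_mul_eq_zero {σ : Type} {P : Matrix ρ σ ℤ}
    (hP : Submodule.span ℚ (Set.range fun x : σ => fun t : ρ => (P t x : ℚ)) = ⊤) {v : ρ → ℤ}
    (hv : ∀ y, ∑ i, v i * P i y = 0) : v = 0 := by
  classical
  have hker : Submodule.span ℚ (Set.range fun x : σ => fun t : ρ => (P t x : ℚ)) ≤
      LinearMap.ker (Fintype.linearCombination ℚ fun i => (v i : ℚ)) := by
    rw [Submodule.span_le]
    rintro _ ⟨y, rfl⟩
    change Fintype.linearCombination ℚ (fun i => (v i : ℚ)) _ = 0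
    rw [Fintype.linearCombination_apply]
    have := congrArg (Int.cast : ℤ → ℚ) (hv y)
    push_cast at this
    rw [← this]
    exact Finset.sum_congr rfl fun i _ => by rw [smul_eq_mul, mul_comm]
  rw [hP, top_le_iff] at hker
  funext i
  have h1 : (Pi.single i 1 : ρ → ℚ) ∈
      LinearMap.ker (Fintype.linearCombination ℚ fun i => (v i : ℚ)) := hker ▸ Submodule.mem_top
  rw [LinearMap.mem_ker, Fintype.linearCombination_apply_single, one_smul] at h1
  exact_mod_cast h1

end GradingGroup

namespace Trinomial

theorem combination_eq_sum {𝕂 : Type*} [Field 𝕂] {σ : Type} {r s : ℕ} (T : Trinomial 𝕂 r σ)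
    {P : Matrix (Fin r ⊕ Fin s) σ ℤ}
    (hP : ∀ t y, P (Sum.inl t) y = (T.expo t.succ y : ℤ) - T.expo 0 y)
    {κ : Fin (r + 1) → ℤ} (hκ : ∑ t, κ t = 0) (D : Fin s → ℤ) (y : σ) :
    T.combination (fun k => P (Sum.inr k)) κ D y =
      ∑ i, (Sum.elim (fun t : Fin r => κ t.succ) D : Fin r ⊕ Fin s → ℤ) i * P i y := by
  rw [Fin.sum_univ_succ] at hκ
  rw [combination, Fin.sum_univ_succ, Fintype.sum_sum_type]
  simp only [Sum.elim_inl, Sum.elim_inr, hP, mul_sub, Finset.sum_sub_distrib, ← Finset.sum_mul]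
  linear_combination (T.expo 0 y : ℤ) * hκ

/-- The grading defined by a matrix whose upper rows are the differences of the block exponents. -/
theorem isGradedBy_deg {𝕂 : Type*} [Field 𝕂] {σ : Type} [Fintype σ] {r s : ℕ}
    (T : Trinomial 𝕂 r σ) {P : Matrix (Fin r ⊕ Fin s) σ ℤ}
    (hP : ∀ t y, P (Sum.inl t) y = (T.expo t.succ y : ℤ) - T.expo 0 y)
    (hgen : Submodule.span ℚ (Set.range fun x : σ => fun t => (P t x : ℚ)) = ⊤) :
    T.IsGradedBy (deg P) fun k => P (Sum.inr k) := by
  refine ⟨fun x => ?_, fun κ D hκ h0 => ?_⟩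
  · rw [linearCombination_deg_eq_zero_iff]
    constructor
    · rintro ⟨v, hv⟩
      have hκ : ∑ t, (Fin.cons (-∑ t, v (Sum.inl t)) fun t => v (Sum.inl t) :
          Fin (r + 1) → ℤ) t = 0 := by
        simp [Fin.sum_univ_succ]
      refine ⟨_, fun k => v (Sum.inr k), hκ, funext fun y => ?_⟩
      rw [T.combination_eq_sum hP hκ, hv y]
      refine Finset.sum_congr rfl fun i _ => ?_
      rcases i with t | k <;> simp
    · rintro ⟨κ, D, hκ, rfl⟩
      exact ⟨_, T.combination_eq_sum hP hκ D⟩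
  · have hv := eq_zero_of_sum_mul_eq_zero hgen fun y =>
      (T.combination_eq_sum hP hκ D y).symm.trans (congrFun h0 y)
    have hs : ∀ t : Fin r, κ t.succ = 0 := fun t => congrFun hv (Sum.inl t)
    refine ⟨funext fun t => ?_, funext fun k => congrFun hv (Sum.inr k)⟩
    rw [Fin.sum_univ_succ, Finset.sum_eq_zero fun t _ => hs t, add_zero] at hκ
    exact Fin.cases hκ hs t

end Trinomial

/-! ### The two types of relations as trinomial data -/

namespace Shape

variable {q : ℕ} (c : Shape q)

/-- The exponent of a variable in the monomial of its block; `1` for the free variables. -/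
def exponent : c.Var → ℕ
  | Sum.inl ⟨i, j⟩ => c.l i j
  | Sum.inr _ => 1

theorem exponent_pos (y : c.Var) : 0 < c.exponent y := by
  rcases y with ⟨i, j⟩ | k
  · exact c.l_pos i j
  · exact one_pos

/-- The block of a variable. -/
def block : c.Var → Option (Fin q)
  | Sum.inl ⟨i, _⟩ => some i
  | Sum.inr _ => none

theorem mon_eq_prod (𝕂 : Type*) [CommRing 𝕂] (i : Fin q) :
    c.mon 𝕂 i = ∏ y, X y ^ (if c.block y = some i then c.exponent y else 0) := by
  rw [Fintype.prod_sum_type, Fintype.prod_sigma, Finset.prod_eq_single i]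
  · simp [mon, block, exponent]
  · intro i' _ hne
    simp [block, hne]
  · simp

end Shape

section Types

variable {𝕂 : Type*} [Field 𝕂] {r : ℕ}

/-- Type 1 data as trinomial data: the block `0` is empty, so that its monomial is the constant
`1`. -/
def trinomial₁ (c : Shape (r + 1)) (a : Fin (r + 1) → 𝕂) (ha : Function.Injective a) :
    Trinomial 𝕂 (r + 1) c.Var where
  blk y := (c.block y).map Fin.succ
  l := c.exponent
  l_pos := c.exponent_pos
  δ := Fin.cons 1 fun i => a 0 - a i
  β := Fin.cons 0 fun _ => 1
  δ_zero := rfl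
  β_zero := rfl
  δ_one := sub_self _
  β_one := rfl
  minor_ne_zero i t hit := by
    cases i using Fin.cases with
    | zero =>
      cases t using Fin.cases with
      | zero => exact absurd rfl hit
      | succ t => simp
    | succ i =>
      cases t using Fin.cases with
      | zero => simp
      | succ t =>
        have : a t ≠ a i := fun h => hit (congrArg Fin.succ (ha h).symm)
        simpa [sub_eq_zero] using this

theorem trinomial₁_mon_zero (c : Shape (r + 1)) (a : Fin (r + 1) → 𝕂)
    (ha : Function.Injective a) : (trinomial₁ c a ha).mon 0 = 1 := by
  refine Finset.prod_eq_one fun y _ => ?_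
  rw [Trinomial.expo, if_neg, pow_zero]
  simp [trinomial₁, Fin.succ_ne_zero]

theorem trinomial₁_expo_succ (c : Shape (r + 1)) (a : Fin (r + 1) → 𝕂)
    (ha : Function.Injective a) (i : Fin (r + 1)) (y : c.Var) :
    (trinomial₁ c a ha).expo i.succ y = if c.block y = some i then c.exponent y else 0 := by
  have : (c.block y).map Fin.succ = some i.succ ↔ c.block y = some i := by
    simp
  simp only [Trinomial.expo, trinomial₁, this]

theorem trinomial₁_mon_succ (c : Shape (r + 1)) (a : Fin (r + 1) → 𝕂)
    (ha : Function.Injective a) (i : Fin (r + 1)) :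
    (trinomial₁ c a ha).mon i.succ = c.mon 𝕂 i := by
  rw [c.mon_eq_prod, Trinomial.mon]
  simp only [trinomial₁_expo_succ]

theorem trinomial₁_span_relations (c : Shape (r + 1)) (a : Fin (r + 1) → 𝕂)
    (ha : Function.Injective a) :
    Ideal.span (trinomial₁ c a ha).relations = Ideal.span (c.relations₁ a) := by
  set T := trinomial₁ c a ha with hT
  have hmon1 : T.mon 1 = c.mon 𝕂 0 := trinomial₁_mon_succ c a ha 0
  have hrel : ∀ i : Fin (r + 1),
      T.mon i.succ - (C (T.δ i.succ) * T.mon 0 + C (T.β i.succ) * T.mon 1)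
      = c.mon 𝕂 i - (C (a 0 - a i) + c.mon 𝕂 0) := by
    intro i
    rw [hmon1, trinomial₁_mon_succ, trinomial₁_mon_zero]
    simp [hT, trinomial₁]
  apply le_antisymm
  · rw [Ideal.span_le]
    rintro _ ⟨t, rfl⟩
    cases t using Fin.cases with
    | zero => simp [T.δ_zero, T.β_zero]
    | succ i =>
      simp only [hrel, SetLike.mem_coe]
      induction i using Fin.induction with
      | zero => simp
      | succ i ih =>
        have hg : c.mon 𝕂 i.castSucc - c.mon 𝕂 i.succ - C (a i.succ - a i.castSucc) ∈
            Ideal.span (c.relations₁ a) :=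
          Ideal.subset_span ⟨i.castSucc, i.succ, by simp, rfl⟩
        have := Ideal.sub_mem _ ih hg
        convert this using 1
        simp only [C_sub]
        ring
  · rw [Ideal.span_le]
    rintro _ ⟨i, i', -, rfl⟩
    have h1 : ∀ i, c.mon 𝕂 i - (C (a 0 - a i) + c.mon 𝕂 0) ∈ Ideal.span T.relations := fun i =>
      hrel i ▸ Ideal.subset_span ⟨i.succ, rfl⟩
    have := Ideal.sub_mem _ (h1 i) (h1 i')
    rw [SetLike.mem_coe]
    convert this using 1
    simp only [C_sub]
    ring

/-- The `2 × 2` minor of the columns `i` and `t`. -/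
def minor {q : ℕ} (a : Matrix (Fin 2) (Fin q) 𝕂) (i t : Fin q) : 𝕂 := a 0 i * a 1 t - a 0 t * a 1 i

theorem minor_ne_zero {q : ℕ} {a : Matrix (Fin 2) (Fin q) 𝕂} {i t : Fin q}
    (h : LinearIndependent 𝕂 ![a.col i, a.col t]) : minor a i t ≠ 0 := by
  intro h0
  have hdet : (Matrix.of ![a.col i, a.col t]).det ≠ 0 := by
    have := Matrix.linearIndependent_rows_iff_isUnit.mp
      (show LinearIndependent 𝕂 (Matrix.of ![a.col i, a.col t]).row from h)
    exact ((Matrix.isUnit_iff_isUnit_det _).mp this).ne_zero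
  apply hdet
  rw [Matrix.det_fin_two]
  simp only [Matrix.of_apply, Matrix.cons_val_zero, Matrix.cons_val_one, Matrix.col_apply]
  rw [← h0, minor]
  ring

/-- Type 2 data as trinomial data: the coefficients are those of the column `a t` in the basis
consisting of the columns `a 0` and `a 1`, by Cramer's rule. -/
def trinomial₂ (c : Shape (r + 1 + 1)) (a : Matrix (Fin 2) (Fin (r + 1 + 1)) 𝕂)
    (ha : ∀ i j, i ≠ j → LinearIndependent 𝕂 ![a.col i, a.col j]) :
    Trinomial 𝕂 (r + 1) c.Var where
  blk := c.block
  l := c.exponent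
  l_pos := c.exponent_pos
  δ t := minor a t 1 / minor a 0 1
  β t := minor a 0 t / minor a 0 1
  δ_zero := div_self (minor_ne_zero (ha 0 1 (by simp)))
  β_zero := by simp [minor]
  δ_one := by simp [minor]
  β_one := div_self (minor_ne_zero (ha 0 1 (by simp)))
  minor_ne_zero i t hit := by
    have h1 := minor_ne_zero (ha 0 1 (by simp))
    have h2 := minor_ne_zero (ha i t hit)
    have : minor a i 1 / minor a 0 1 * (minor a 0 t / minor a 0 1) -
        minor a 0 i / minor a 0 1 * (minor a t 1 / minor a 0 1) =
        minor a i t / minor a 0 1 := by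
      field_simp
      simp only [minor]
      ring
    rw [this]
    exact div_ne_zero h2 h1

theorem trinomial₂_mon (c : Shape (r + 1 + 1)) (a : Matrix (Fin 2) (Fin (r + 1 + 1)) 𝕂)
    (ha : ∀ i j, i ≠ j → LinearIndependent 𝕂 ![a.col i, a.col j]) (i : Fin (r + 1 + 1)) :
    (trinomial₂ c a ha).mon i = c.mon 𝕂 i := by
  rw [c.mon_eq_prod]
  rfl

theorem trinomial₂_apply (c : Shape (r + 1 + 1)) (a : Matrix (Fin 2) (Fin (r + 1 + 1)) 𝕂)
    (ha : ∀ i j, i ≠ j → LinearIndependent 𝕂 ![a.col i, a.col j]) (p : Fin 2)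
    (i : Fin (r + 1 + 1)) :
    a p i = (trinomial₂ c a ha).δ i * a p 0 + (trinomial₂ c a ha).β i * a p 1 := by
  have h1 := minor_ne_zero (ha 0 1 (by simp))
  simp only [trinomial₂]
  field_simp
  fin_cases p <;> simp [minor] <;> ring

theorem trinomial₂_span_relations (c : Shape (r + 1 + 1))
    (a : Matrix (Fin 2) (Fin (r + 1 + 1)) 𝕂)
    (ha : ∀ i j, i ≠ j → LinearIndependent 𝕂 ![a.col i, a.col j]) :
    Ideal.span (trinomial₂ c a ha).relations = Ideal.span (c.relations₂ a) := by
  set T := trinomial₂ c a ha with hT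
  have hmon : ∀ t, T.mon t = c.mon 𝕂 t := trinomial₂_mon c a ha
  have happ : ∀ p t, a p t = T.δ t * a p 0 + T.β t * a p 1 := trinomial₂_apply c a ha
  apply le_antisymm
  · have key : ∀ n, ∀ hn : n < r + 1 + 1, T.mon ⟨n, hn⟩ -
        (C (T.δ ⟨n, hn⟩) * T.mon 0 + C (T.β ⟨n, hn⟩) * T.mon 1) ∈ Ideal.span (c.relations₂ a) := by
      intro n
      induction n using Nat.strong_induction_on with
      | _ n ih =>
        intro hn
        match n, ih, hn with
        | 0, _, hn =>
          have : (⟨0, hn⟩ : Fin (r + 1 + 1)) = 0 := rfl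
          rw [this, T.δ_zero, T.β_zero]
          simp
        | 1, _, hn =>
          have : (⟨1, hn⟩ : Fin (r + 1 + 1)) = 1 := rfl
          rw [this, T.δ_one, T.β_one]
          simp
        | n + 2, ih, hn =>
          have h0 := ih n (by omega) (by omega)
          have h1 := ih (n + 1) (by omega) (by omega)
          set i : Fin (r + 1 + 1) := ⟨n, by omega⟩
          set i' : Fin (r + 1 + 1) := ⟨n + 1, by omega⟩
          set i'' : Fin (r + 1 + 1) := ⟨n + 2, hn⟩
          have hg : Matrix.det !![c.mon 𝕂 i, c.mon 𝕂 i', c.mon 𝕂 i'';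
              C (a 0 i), C (a 0 i'), C (a 0 i''); C (a 1 i), C (a 1 i'), C (a 1 i'')] ∈
              Ideal.span (c.relations₂ a) := Ideal.subset_span ⟨i, i', i'', rfl, rfl, rfl⟩
          have hM : minor a i i' ≠ 0 := minor_ne_zero (ha i i' (by simp [i, i']))
          -- The determinant is linear in the monomials, and vanishes on the forms in the blocks
          -- `0` and `1`.
          have hcomb : C (minor a i i') *
              (T.mon i'' - (C (T.δ i'') * T.mon 0 + C (T.β i'') * T.mon 1))
              ∈ Ideal.span (c.relations₂ a) := by
            have := Ideal.add_mem _ (Ideal.sub_mem _ hg (Ideal.mul_mem_left _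
              (C (minor a i' i'')) h0)) (Ideal.mul_mem_left _ (C (minor a i i'')) h1)
            convert this using 1
            rw [Matrix.det_fin_three]
            simp only [minor, ← hmon, Matrix.of_apply, Matrix.cons_val', Matrix.cons_val_zero,
              Matrix.cons_val_one, Matrix.cons_val_fin_one, Matrix.cons_val]
            rw [happ 0 i, happ 1 i, happ 0 i', happ 1 i', happ 0 i'', happ 1 i'']
            simp only [C_sub, C_mul, C_add]
            ring
          have := Ideal.mul_mem_left _ (C (minor a i i')⁻¹) hcomb
          rwa [← mul_assoc, ← C_mul, inv_mul_cancel₀ hM, C_1, one_mul] at this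
    rw [Ideal.span_le]
    rintro _ ⟨t, rfl⟩
    exact key t.1 t.2
  · rw [Ideal.span_le]
    rintro _ ⟨i, i', i'', -, -, rfl⟩
    rw [SetLike.mem_coe]
    have h := fun t => Ideal.subset_span (α := MvPolynomial c.Var 𝕂) (s := T.relations) ⟨t, rfl⟩
    have := Ideal.add_mem _ (Ideal.sub_mem _ (Ideal.mul_mem_left _ (C (minor a i' i'')) (h i))
      (Ideal.mul_mem_left _ (C (minor a i i'')) (h i')))
      (Ideal.mul_mem_left _ (C (minor a i i')) (h i''))
    convert this using 1
    rw [Matrix.det_fin_three]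
    simp only [minor, ← hmon, Matrix.of_apply, Matrix.cons_val', Matrix.cons_val_zero,
      Matrix.cons_val_one, Matrix.cons_val_fin_one, Matrix.cons_val]
    rw [happ 0 i, happ 1 i, happ 0 i', happ 1 i', happ 0 i'', happ 1 i'']
    simp only [C_sub, C_mul, C_add]
    ring

theorem P₀₁_apply (c : Shape (r + 1)) (a : Fin (r + 1) → 𝕂) (ha : Function.Injective a)
    (t : Fin (r + 1)) (y : c.Var) :
    c.P₀₁ t y = ((trinomial₁ c a ha).expo t.succ y : ℤ) - (trinomial₁ c a ha).expo 0 y := by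
  have h0 : (trinomial₁ c a ha).expo 0 y = 0 := by
    rw [Trinomial.expo, if_neg]
    simp [trinomial₁, Fin.succ_ne_zero]
  rw [h0, trinomial₁_expo_succ]
  rcases y with ⟨i, j⟩ | k <;> simp [Shape.P₀₁, Shape.block, Shape.exponent]

theorem P₀₂_apply (c : Shape (r + 1 + 1)) (a : Matrix (Fin 2) (Fin (r + 1 + 1)) 𝕂)
    (ha : ∀ i j, i ≠ j → LinearIndependent 𝕂 ![a.col i, a.col j]) (t : Fin (r + 1)) (y : c.Var) :
    c.P₀₂ t y = ((trinomial₂ c a ha).expo t.succ y : ℤ) - (trinomial₂ c a ha).expo 0 y := by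
  rcases y with ⟨i, j⟩ | k
  · by_cases hi : i = 0
    · subst hi
      simp [Trinomial.expo, trinomial₂, Shape.P₀₂, Shape.block, Shape.exponent,
        (Fin.succ_ne_zero t).symm]
    · simp [Trinomial.expo, trinomial₂, Shape.P₀₂, Shape.block, Shape.exponent, hi]
  · simp [Trinomial.expo, trinomial₂, Shape.P₀₂, Shape.block]

/-- Both types of data are instances of the common shape `Trinomial`: the relations span the same
ideal, and the rows of `P₀` are the differences of the block exponents. -/
theorem exists_trinomial (D : Data 𝕂 (r + 1)) : ∃ T : Trinomial 𝕂 (r + 1) D.Var,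
    Ideal.span T.relations = Ideal.span D.relations ∧
    ∀ t y, D.P₀ t y = (T.expo t.succ y : ℤ) - T.expo 0 y := by
  rcases D with ⟨c, a, ha⟩ | ⟨c, a, ha⟩
  · exact ⟨trinomial₁ c a ha, trinomial₁_span_relations c a ha, P₀₁_apply c a ha⟩
  · exact ⟨trinomial₂ c a ha, trinomial₂_span_relations c a ha, P₀₂_apply c a ha⟩

end Types

end ComplexityOne

theorem theorem3 {𝕂 : Type*} [Field 𝕂] [IsAlgClosed 𝕂] [CharZero 𝕂]
    (r : ℕ) (hr : 0 < r) (D : ComplexityOne.Data 𝕂 r)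
    (s : ℕ) (hs : 1 ≤ s) (hs' : s + r ≤ Fintype.card D.Var)
    (d : Matrix (Fin s) D.Var ℤ) (hP : ComplexityOne.IsAdmissible (D.P d)) :
    ComplexityOne.IsGrading (D.grading d) ∧
    ComplexityOne.IsAlmostFree (ComplexityOne.deg (D.P d)) ∧
    ComplexityOne.IsFactorialGrading (D.grading d) ∧
    ComplexityOne.OnlyConstantHomogeneousUnits (D.grading d) ∧
    (∀ x, D.var x ∈ D.grading d (ComplexityOne.deg (D.P d) x)) ∧
    (∀ x, ComplexityOne.IsGradedPrime (D.grading d) (D.var x)) ∧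
    Algebra.adjoin 𝕂 (Set.range D.var) = ⊤ ∧
    Function.Injective D.var ∧
    (∀ x y, x ≠ y → ¬ Associated (D.var x) (D.var y)) := by
  obtain ⟨r, rfl⟩ : ∃ n, r = n + 1 := ⟨r - 1, by omega⟩
  obtain ⟨T, hspan, hT⟩ := ComplexityOne.exists_trinomial D
  have hG := T.isGradedBy_deg (P := D.P d) hT hP.generate
  obtain ⟨h1, h2, h3, h4, hnd⟩ := hG.quotientGrading_properties hspan
  refine ⟨h1, ComplexityOne.isAlmostFree_deg _ hP.primitive, h2, h3, ?_, h4, ?_, ?_, ?_⟩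
  · exact fun x => ⟨MvPolynomial.X x, MvPolynomial.isWeightedHomogeneous_X 𝕂 _ x, rfl⟩
  · have : Set.range D.var =
        Ideal.Quotient.mkₐ 𝕂 (Ideal.span D.relations) '' Set.range MvPolynomial.X := by
      rw [← Set.range_comp]
      rfl
    rw [this, ← AlgHom.map_adjoin, MvPolynomial.adjoin_range_X, Algebra.map_top,
      AlgHom.range_eq_top]
    exact Ideal.Quotient.mkₐ_surjective 𝕂 _
  · intro x y hxy
    by_contra hne
    exact hnd x y hne (dvd_of_eq hxy)
  · exact fun x y hxy h => hnd x y hxy h.dvd
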